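/- **Setting.** Let $L\ge 1$, $n_0,\dots,n_{L+1}\ge 1$ be integers, $C_W>0$, $C_b\ge 0$, let $\sigma:\mathbb R\to\mathbb R$ be Borel measurable (for instance Lipschitz continuous) and $x\in\mathbb R^{n_0}$. Define $$z_j^{(1)}(x)=b_j^{(1)}+\sqrt{\tfrac{C_W}{n_0}}\sum_{k=1}^{n_0}W^{(1)}_{j,k}x_k,\qquad z_j^{(\ell)}(x)=b_j^{(\ell)}+\sqrt{\tfrac{C_W}{n_{\ell-1}}}\sum_{k=1}^{n_{\ell-1}}W^{(\ell)}_{j,k}\,\sigma\big(z_k^{(\ell-1)}(x)\big)\quad(2\le \ell\le L+1),$$ for $1\le j\le n_\ell$, where the biases $b_j^{(\ell)}\sim\mathcal N(0,C_b)$ and the weights $W_{j,k}^{(\ell)}$ are all mutually independent and the weights are identically distributed with mean $0$ and variance $1$. Define $K^{(2)}=C_b+C_W\,\mathbb E[\sigma(z_1^{(1)}(x))^2]$ and $K^{(\ell+1)}=C_b+C_W\,\mathbb E[\sigma(G^{(\ell)})^2]$ with $G^{(\ell)}\sim\mathcal N(0,K^{(\ell)})$ for $\ell\ge 2$. (For Lipschitz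 $\sigma$ these expectations are finite; for other $\sigma$ a divergent one is read as $0$.) Put $$Q_2^{(L)}(x)=\mathbb E\Big[\Big|\sum_{j=1}^{n_L}\frac{C_W}{n_L}\sigma\big(z_j^{(L)}(x)\big)^2-K^{(L+1)}+C_b\Big|^2\Big].$$ Let $d_K(X,Y)=\sup_{t\in\mathbb R}|\mathbb P(X\le t)-\mathbb P(Y\le t)|$ be the Kolmogorov distance. **(1)** If $\mathbb E[(W_{1,1}^{(1)})^6]<\infty$, $\mathbb E[|\sigma(z_1^{(L)}(x))|^6]<\infty$ and $K^{(L+1)}\ne 0$, then, with $G_1^{(L+1)}(x)\sim\mathcal N(0,K^{(L+1)})$, $$d_K\big(z_1^{(L+1)}(x),G_1^{(L+1)}(x)\big)\le\frac{\sqrt{Q_2^{(L)}(x)}}{K^{(L+1)}}+\frac{C_W}{K^{(L+1)}\sqrt{n_L}}\,\mathbb E\big[(W_{1,1}^{(1)})^6\big]^{1/2}\Big(1+\mathbb E\big[|\sigma(z_1^{(L)}(x))|^6\big]^{1/2}\Big)\Big(2\sqrt{\tfrac{C_W}{K^{(L+1)}}}+2\sqrt{C_W}\Big(\sqrt{\tfrac{C_b}{K^{(L+1)}}}+\tfrac{\sqrt{2\pi}}4\Big)+\tfrac52\Big).$$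 **(2)** Let $E$ be a Polish space, $X=(X_1,\dots,X_k)$ a random vector in $E^k$ with independent components, $X'$ an independent copy of $X$, $f:E^k\to\mathbb R$ measurable with $\mathbb E[f(X)]=0$ and $\mathbb E[f(X)^6]<\infty$, let $C_b\ge0$, let $b\sim\mathcal N(0,C_b)$ be independent of $X$, and let $N\sim\mathcal N(0,K)$ with $K>0$. For $A\subseteq[k]=\{1,\dots,k\}$ let $X^A$ be the vector whose $i$-th coordinate is $X_i'$ if $i\in A$ and $X_i$ if $i\notin A$; for $j\notin A$ put $\Delta_jf(X^A)=f(X^A)-f(X^{A\cup\{j\}})$, and $\Delta_jf(X)=\Delta_jf(X^{\emptyset})$. Put $$T=\frac12\sum_{A\subsetneq[k]}\frac{1}{\binom k{|A|}(k-|A|)}\sum_{j\notin A}\Delta_jf(X)\,\Delta_jf(X^A),\qquad T'=\frac12\sum_{A\subsetneq[k]}\frac{1}{\binom k{|A|}(k-|A|)}\sum_{j\notin A}\Delta_jf(X)\,\big|\Delta_jf(X^A)\big|.$$ Then $$d_K(b+f(X),N)\le\frac1K\,\mathbb E\Big[\big(\mathbb E[K-C_b-T\mid X]\big)^2\Big]^{1/2}+\frac1K\big(\operatorname{Var}\mathbb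 E[T'\mid X]\big)^{1/2}+\frac14\Big(\sqrt{\tfrac{C_b}K}+\tfrac{\sqrt{2\pi}}4\Big)\sum_{j=1}^k\frac1K\,\mathbb E\big[|\Delta_jf(X)|^3\big]+\frac1{4K\sqrt K}\sum_{j=1}^k\mathbb E\big[|\Delta_jf(X)|^6\big]^{1/2}.$$ -/

import Mathlib

open MeasureTheory ProbabilityTheory
open scoped NNReal

noncomputable section

/-- Kolmogorov distance `sup_t |μ (-∞, t] - ν (-∞, t]|` between two laws on the real line
(used for probability measures only, where the supremum is over a bounded set). -/
def kolDist (μ ν : Measure ℝ) : ℝ :=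
  ⨆ t : ℝ, |μ.real (Set.Iic t) - ν.real (Set.Iic t)|

/-- A random fully connected neural network with `L` hidden layers on the probability space
`(Ω, P)`.

`width ℓ` is the number of neurons `n_ℓ` of layer `ℓ` (`n_0` is the input dimension), and
`weight ℓ j k`, `bias ℓ j` are the parameters which lead from layer `ℓ` to layer `ℓ + 1`, that is
`W_{j,k}^{(ℓ+1)}` and `b_j^{(ℓ+1)}`.
Only layers `0, …, L + 1` and parameters with `ℓ ≤ L` belong to the network: nothing is assumed on
the other entries (except that the unused widths are positive). -/
structure RandomNN {Ω : Type*} [MeasurableSpace Ω] (P : Measure Ω) (L : ℕ) where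
  width : ℕ → ℕ
  width_pos : ∀ ℓ, 0 < width ℓ
  /-- activation function -/
  σ : ℝ → ℝ
  measurable_σ : Measurable σ
  /-- weight variance `C_W > 0` -/
  CW : ℝ≥0
  CW_pos : 0 < CW
  /-- bias variance `C_b ≥ 0` -/
  Cb : ℝ≥0
  weight : (ℓ : ℕ) → Fin (width (ℓ + 1)) → Fin (width ℓ) → Ω → ℝ
  bias : (ℓ : ℕ) → Fin (width (ℓ + 1)) → Ω → ℝ
  measurable_weight : ∀ ℓ ≤ L, ∀ j k, Measurable (weight ℓ j k)
  measurable_bias : ∀ ℓ ≤ L, ∀ j, Measurable (bias ℓ j)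
  /-- the law of the generic weight `W` -/
  weightLaw : Measure ℝ
  memLp_weightLaw : MemLp id 2 weightLaw
  mean_weightLaw : ∫ w, w ∂weightLaw = 0
  sq_weightLaw : ∫ w, w ^ 2 ∂weightLaw = 1
  hasLaw_weight : ∀ ℓ ≤ L, ∀ j k, HasLaw (weight ℓ j k) weightLaw P
  hasLaw_bias : ∀ ℓ ≤ L, ∀ j, HasLaw (bias ℓ j) (gaussianReal 0 Cb) P
  /-- all the weights and all the biases together are mutually independent -/
  indep : iIndepFun
    (Sum.elim
      (fun p : Σ ℓ : Fin (L + 1), Fin (width (ℓ + 1)) × Fin (width ℓ) =>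
        weight p.1 p.2.1 p.2.2)
      (fun p : Σ ℓ : Fin (L + 1), Fin (width (ℓ + 1)) => bias p.1 p.2)) P

namespace RandomNN

variable {Ω : Type*} [MeasurableSpace Ω] {P : Measure Ω} {L : ℕ}

/-- The index of the first neuron of layer `ℓ`. -/
def fst (N : RandomNN P L) (ℓ : ℕ) : Fin (N.width ℓ) := ⟨0, N.width_pos ℓ⟩

/-- `N.z x ℓ j` is the random variable `z_j^{(ℓ)}(x)`, for `ℓ = 1, …, L + 1`; by convention
`N.z x 0` is the input `x`. -/
def z (N : RandomNN P L) (x : Fin (N.width 0) → ℝ) : (ℓ : ℕ) → Fin (N.width ℓ) → Ω → ℝ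
  | 0 => fun k _ => x k
  | 1 => fun j ω => N.bias 0 j ω +
      √(N.CW : ℝ) / √(N.width 0 : ℝ) * ∑ k, N.weight 0 j k ω * x k
  | ℓ + 2 => fun j ω => N.bias (ℓ + 1) j ω +
      √(N.CW : ℝ) / √(N.width (ℓ + 1) : ℝ) *
        ∑ k, N.weight (ℓ + 1) j k ω * N.σ (N.z x (ℓ + 1) k ω)

/-- `N.K x ℓ` is the infinite-width variance `K^{(ℓ)}` at the input `x`, for `ℓ ≥ 2`:
`K^{(2)} = C_b + C_W E[σ(z_1^{(1)}(x))²]` and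
`K^{(ℓ+1)} = C_b + C_W E[σ(G)²]` with `G ∼ N(0, K^{(ℓ)})`.
The values at `0` and `1` are unused. -/
def K (N : RandomNN P L) (x : Fin (N.width 0) → ℝ) : ℕ → ℝ≥0
  | 0 => 0
  | 1 => 0
  | 2 => N.Cb + N.CW * (∫ ω, N.σ (N.z x 1 (N.fst 1) ω) ^ 2 ∂P).toNNReal
  | ℓ + 3 => N.Cb + N.CW * (∫ y, N.σ y ^ 2 ∂(gaussianReal 0 (N.K x (ℓ + 2)))).toNNReal

/-- `Q_p^{(ℓ)}(x) = E |∑_j (C_W / n_ℓ) σ(z_j^{(ℓ)}(x))² - K^{(ℓ+1)} + C_b|^p`. -/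
def Q (N : RandomNN P L) (x : Fin (N.width 0) → ℝ) (p ℓ : ℕ) : ℝ :=
  ∫ ω, |∑ j, (N.CW : ℝ) / (N.width ℓ : ℝ) * N.σ (N.z x ℓ j ω) ^ 2
    - (N.K x (ℓ + 1) : ℝ) + (N.Cb : ℝ)| ^ p ∂P

end RandomNN

section Resampling

variable {E : Type*} {k : ℕ}

/-- `X^A`: the coordinates in `A` are taken from `x'`, the others from `x`. -/
def resample (x x' : Fin k → E) (A : Finset (Fin k)) : Fin k → E :=
  fun i => if i ∈ A then x' i else x i

/-- `Δ_j f (X^A) = f(X^A) - f(X^{A ∪ {j}})`; in particular for `A = ∅` this is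
`Δ_j f(X) = f(X) - f(X^j)`, where `X^j` is `X` with its `j`-th coordinate taken from `X'`. -/
def resampleDiff (f : (Fin k → E) → ℝ) (j : Fin k) (A : Finset (Fin k)) (x x' : Fin k → E) : ℝ :=
  f (resample x x' A) - f (resample x x' (insert j A))

/-- `T = ½ ∑_{A ⊊ [k]} 1 / (C(k,|A|) (k - |A|)) ∑_{j ∉ A} Δ_j f(X) Δ_j f(X^A)`. -/
def steinT (f : (Fin k → E) → ℝ) (x x' : Fin k → E) : ℝ :=
  1 / 2 * ∑ A ∈ (Finset.univ : Finset (Fin k)).ssubsets,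
    1 / ((k.choose A.card : ℝ) * ((k : ℝ) - (A.card : ℝ))) *
      ∑ j ∈ Aᶜ, resampleDiff f j ∅ x x' * resampleDiff f j A x x'

/-- `T' = ½ ∑_{A ⊊ [k]} 1 / (C(k,|A|) (k - |A|)) ∑_{j ∉ A} Δ_j f(X) |Δ_j f(X^A)|`. -/
def steinT' (f : (Fin k → E) → ℝ) (x x' : Fin k → E) : ℝ :=
  1 / 2 * ∑ A ∈ (Finset.univ : Finset (Fin k)).ssubsets,
    1 / ((k.choose A.card : ℝ) * ((k : ℝ) - (A.card : ℝ))) *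
      ∑ j ∈ Aᶜ, resampleDiff f j ∅ x x' * |resampleDiff f j A x x'|

end Resampling

end

noncomputable section

/-! ### Gaussian integration by parts. -/

section Gaussian

open Set Filter Topology

/-! The proof is Stein's method with Chatterjee's exchange of coordinates. The particular point is
how the Taylor remainder of the Stein solution is handled.

For the indicator of `(-∞, t]`, the solution `F` of Stein's equation is, up to a linear term, a
difference `H - p` of two convex functions (divided by the variance): `H` comes from the Mills
ratio, and `p` is the kink `max (w - t) 0`. The first-order remainder of a convex function has a
sign, so the remainder of `F` is at most the sum of the two nonnegative remainders, that is, the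
remainder of the convex function `Ψ = H + p`: `|F w - F w' - F' w (w - w')| ≤ Ψ w' - Ψ w + ψ w (w -
w')` (`exists_stein_solution`). No smoothness of `F'` at `t` is needed. Averaging over the Gaussian
noise `b` keeps this inequality, and integration by parts in `b` replaces the variance `K` by `K -
c` in the equation (`exists_smoothed_stein_solution`). The noise is thus treated exactly.

Chatterjee's identity writes `E[g(f(X)) f(X)]` as a weighted sum of `E[g(f(X)) Δ_j f(X^A)]`.
Exchanging `X_j` and `X'_j` changes the sign of `Δ_j f(X^A)`, so each term is half of `E[(g(f(X)) -
g(f(X^j))) Δ_j f(X^A)]`. In the Taylor expansion the main term sums to `T`. The remainder is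
multiplied by `|Δ_j f(X^A)|`, which is invariant under the exchange: `Ψ(f(X^j)) - Ψ(f(X))` then
integrates to zero, and what is left, `ψ(f(X)) Δ_j f(X) |Δ_j f(X^A)|`, sums to `T'`. This gives (2)
with its first two terms alone (`exists_abs_integral_gaussianReal_sub_le`, `kolDist_add_le`); the
third and fourth terms are nonnegative and are added at the end.

For (1), condition on layer `L`. The output neuron becomes Gaussian noise plus a linear form `∑ a_j
W_j` with fixed coefficients, for which `T` and `T'` are sums of independent terms with computable
second moments (`abs_integral_linear_gaussianReal_sub_le`). This conditional bound holds for every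
target variance `K > 0`, so the recursion defining `K^{(L+1)}` is never unfolded. Averaging over the
coefficients produces `Q` and the fourth moment of `σ(z)`, and the constant `5/2` alone suffices
(`RandomNN.kolDist_output_le`). -/

lemma integrable_gaussianReal_iff {v : ℝ≥0} (hv : v ≠ 0) {f : ℝ → ℝ} :
    Integrable f (gaussianReal 0 v) ↔ Integrable (fun x => gaussianPDFReal 0 v x * f x) := by
  rw [gaussianReal_of_var_ne_zero _ hv, integrable_withDensity_iff_integrable_smul'
    (measurable_gaussianPDF _ _) (by simp [gaussianPDF_lt_top])]
  simp [toReal_gaussianPDF]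

lemma integrable_pow_gaussianReal (v : ℝ≥0) (n : ℕ) :
    Integrable (fun x : ℝ => x ^ n) (gaussianReal 0 v) := by
  have := (memLp_id_gaussianReal' (μ := 0) (v := v) n (by simp)).integrable_norm_pow'
  refine (integrable_norm_iff (by fun_prop)).1 ?_
  simpa using this

lemma hasDerivAt_gaussianPDFReal {v : ℝ≥0} (hv : v ≠ 0) (x : ℝ) :
    HasDerivAt (gaussianPDFReal 0 v) (-(x / v) * gaussianPDFReal 0 v x) x := by
  have hv' : (v : ℝ) ≠ 0 := by exact_mod_cast hv
  rw [gaussianPDFReal_def]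
  have h : HasDerivAt (fun x : ℝ => -(x - 0) ^ 2 / (2 * (v : ℝ))) (-(x / v)) x := by
    have := ((((hasDerivAt_id x).sub_const 0).pow 2).neg.div_const (2 * (v : ℝ)))
    refine this.congr_deriv ?_
    simp only [id_eq, sub_zero]; norm_num; field_simp
  have := h.exp.const_mul (√(2 * Real.pi * v))⁻¹
  refine this.congr_deriv ?_
  ring

/-- Gaussian integration by parts for a function which may fail to be differentiable at `a`. -/
lemma integral_id_mul_gaussianReal {v : ℝ≥0} {G G' : ℝ → ℝ} {a : ℝ} (hG : Continuous G)
    (hd : ∀ x ≠ a, HasDerivAt G (G' x) x) (hG' : Measurable G') {C : ℝ}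
    (hlin : ∀ x, |G x| ≤ C * (1 + |x|)) (hbd : ∀ x, |G' x| ≤ C) :
    ∫ x, x * G x ∂gaussianReal 0 v = v * ∫ x, G' x ∂gaussianReal 0 v := by
  rcases eq_or_ne v 0 with rfl | hv
  · simp [gaussianReal_zero_var]
  have hv' : (v : ℝ) ≠ 0 := by exact_mod_cast hv
  have i1 : Integrable (fun x : ℝ => x) (gaussianReal 0 v) := by
    simpa using integrable_pow_gaussianReal v 1
  have i2 := integrable_pow_gaussianReal v 2
  have iG : Integrable G (gaussianReal 0 v) := by
    refine Integrable.mono' (((integrable_const 1).add i1.abs).const_mul C)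
      hG.aestronglyMeasurable (ae_of_all _ fun x => ?_)
    simpa using hlin x
  have ixG : Integrable (fun x => x * G x) (gaussianReal 0 v) := by
    refine Integrable.mono' ((i1.abs.add i2).const_mul C)
      (continuous_id.mul hG).aestronglyMeasurable (ae_of_all _ fun x => ?_)
    have := mul_le_mul_of_nonneg_left (hlin x) (abs_nonneg x)
    simp only [Real.norm_eq_abs, abs_mul, Pi.add_apply]
    calc |x| * |G x| ≤ |x| * (C * (1 + |x|)) := this
      _ = C * (|x| + |x| ^ 2) := by ring
      _ = _ := by rw [sq_abs]
  have iG' : Integrable G' (gaussianReal 0 v) :=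
    Integrable.of_bound hG'.aestronglyMeasurable C (ae_of_all _ hbd)
  -- With `φ` the density, `-v φ G` has derivative `φ (x G - v G')` off `a`. Integrating it on both
  -- sides of `a`, the values at `a` cancel by continuity, and the limits at infinity vanish because
  -- `u` and `u'` are integrable.
  set u : ℝ → ℝ := fun x => -v * (gaussianPDFReal 0 v x * G x) with hu
  set u' : ℝ → ℝ := fun x => gaussianPDFReal 0 v x * (x * G x - v * G' x) with hu'
  have iu : Integrable u := ((integrable_gaussianReal_iff hv).1 iG).const_mul _
  have iu' : Integrable u' := (integrable_gaussianReal_iff hv).1 (ixG.sub (iG'.const_mul _))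
  have hcont : Continuous u := by
    have : Continuous (gaussianPDFReal 0 v) :=
      continuous_iff_continuousAt.2 fun x => (hasDerivAt_gaussianPDFReal hv x).continuousAt
    fun_prop
  have hder : ∀ x ≠ a, HasDerivAt u (u' x) x := by
    intro x hx
    have := ((hasDerivAt_gaussianPDFReal hv x).mul (hd x hx)).const_mul (-(v : ℝ))
    refine this.congr_deriv ?_
    simp only [hu']; field_simp; ring
  have e1 := integral_Iic_of_hasDerivAt_of_tendsto (a := a) (f := u) (f' := u') (m := 0)
    hcont.continuousWithinAt (fun x hx => hder x (ne_of_lt hx)) iu'.integrableOn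
    -- The half-line is closed, so it stops at `a - 1` to avoid the point where `G` may fail to be
    -- differentiable.
    (tendsto_zero_of_hasDerivAt_of_integrableOn_Iic (a := a - 1)
      (fun x hx => hder x (by simp only [mem_Iic] at hx; linarith)) iu'.integrableOn iu.integrableOn)
  have e2 := integral_Ioi_of_hasDerivAt_of_tendsto (a := a) (f := u) (f' := u') (m := 0)
    hcont.continuousWithinAt (fun x hx => hder x (ne_of_gt hx)) iu'.integrableOn
    (tendsto_zero_of_hasDerivAt_of_integrableOn_Ioi (a := a)
      (fun x hx => hder x (ne_of_gt hx)) iu'.integrableOn iu.integrableOn)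
  have e3 := intervalIntegral.integral_Iic_add_Ioi (b := a) iu'.integrableOn iu'.integrableOn
  have e4 : ∫ x, (x * G x - v * G' x) ∂gaussianReal 0 v = 0 := by
    rw [integral_gaussianReal_eq_integral_smul hv]
    simp only [smul_eq_mul]
    linarith
  rw [integral_sub ixG (iG'.const_mul _), integral_const_mul] at e4
  linarith

end Gaussian

/-! ### Convexity of the Mills ratio minus the identity. -/

section MillsRatio

open Set Filter Topology

/-- The distribution function of the centred Gaussian law of variance `v`. -/
def gaussCDF (v : ℝ≥0) (w : ℝ) : ℝ := (gaussianReal 0 v).real (Iic w)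

lemma gaussCDF_nonneg (v : ℝ≥0) (w : ℝ) : 0 ≤ gaussCDF v w := measureReal_nonneg

lemma gaussCDF_le_one (v : ℝ≥0) (w : ℝ) : gaussCDF v w ≤ 1 := measureReal_le_one

lemma continuous_gaussianPDFReal {v : ℝ≥0} (hv : v ≠ 0) : Continuous (gaussianPDFReal 0 v) :=
  continuous_iff_continuousAt.2 fun x => (hasDerivAt_gaussianPDFReal hv x).continuousAt

lemma gaussCDF_eq_integral {v : ℝ≥0} (hv : v ≠ 0) (w : ℝ) :
    gaussCDF v w = ∫ x in Iic w, gaussianPDFReal 0 v x := by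
  rw [gaussCDF, measureReal_def, gaussianReal_apply_eq_integral 0 hv, ENNReal.toReal_ofReal]
  exact integral_nonneg fun x => gaussianPDFReal_nonneg 0 v x

lemma hasDerivAt_gaussCDF {v : ℝ≥0} (hv : v ≠ 0) (w : ℝ) :
    HasDerivAt (gaussCDF v) (gaussianPDFReal 0 v w) w := by
  have hc := continuous_gaussianPDFReal hv
  have hi : Integrable (gaussianPDFReal 0 v) := integrable_gaussianPDFReal 0 v
  have e : gaussCDF v = fun w => gaussCDF v 0 + ∫ x in (0 : ℝ)..w, gaussianPDFReal 0 v x := by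
    funext w
    rw [gaussCDF_eq_integral hv, gaussCDF_eq_integral hv,
      ← intervalIntegral.integral_Iic_sub_Iic hi.integrableOn hi.integrableOn]
    ring
  rw [e]
  exact (intervalIntegral.integral_hasDerivAt_right hi.intervalIntegrable
    (hc.stronglyMeasurableAtFilter _ _) hc.continuousAt).const_add _

lemma gaussCDF_neg {v : ℝ≥0} (hv : v ≠ 0) (w : ℝ) : gaussCDF v (-w) = 1 - gaussCDF v w := by
  have := nullSingletonClass_gaussianReal (μ := 0) hv
  have h1 : gaussCDF v (-w) = (gaussianReal 0 v).real (Ici w) := by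
    have hm : (gaussianReal 0 v).map (fun x => -x) = gaussianReal 0 v := by
      rw [gaussianReal_map_neg, neg_zero]
    rw [gaussCDF, ← hm, map_measureReal_apply measurable_neg measurableSet_Iic,
      hm, neg_preimage, neg_Iic, neg_neg]
  rw [h1, gaussCDF, ← probReal_compl_eq_one_sub measurableSet_Iic, compl_Iic]
  exact measureReal_congr Ioi_ae_eq_Ici.symm

lemma gaussianPDFReal_neg (v : ℝ≥0) (w : ℝ) :
    gaussianPDFReal 0 v (-w) = gaussianPDFReal 0 v w := by
  simp [gaussianPDFReal_def]

/-- Nonnegativity of the first-order Gaussian tail expression. -/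
lemma mul_gaussCDF_add_nonneg {v : ℝ≥0} (hv : v ≠ 0) (w : ℝ) :
    0 ≤ w * gaussCDF v w + v * gaussianPDFReal 0 v w := by
  have i0 : Integrable (gaussianPDFReal 0 v) := integrable_gaussianPDFReal 0 v
  have i1 : Integrable (fun x => gaussianPDFReal 0 v x * x) :=
    (integrable_gaussianReal_iff hv).1 (by simpa using integrable_pow_gaussianReal v 1)
  have hv' : (v : ℝ) ≠ 0 := by exact_mod_cast hv
  have hd : ∀ x, HasDerivAt (fun x => -(v : ℝ) * gaussianPDFReal 0 v x)
      (gaussianPDFReal 0 v x * x) x := fun x =>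
    ((hasDerivAt_gaussianPDFReal hv x).const_mul (-(v : ℝ))).congr_deriv (by field_simp)
  have e1 := integral_Iic_of_hasDerivAt_of_tendsto' (a := w) (fun x _ => hd x) i1.integrableOn
    (tendsto_zero_of_hasDerivAt_of_integrableOn_Iic (a := w) (fun x _ => hd x) i1.integrableOn
      (i0.const_mul _).integrableOn)
  have e2 : ∫ x in Iic w, (w - x) * gaussianPDFReal 0 v x =
      w * gaussCDF v w + v * gaussianPDFReal 0 v w := by
    rw [gaussCDF_eq_integral hv, ← integral_const_mul]
    have : ∀ x, (w - x) * gaussianPDFReal 0 v x =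
      w * gaussianPDFReal 0 v x - gaussianPDFReal 0 v x * x := fun x => by ring
    simp_rw [this]
    rw [integral_sub (i0.const_mul _).integrableOn i1.integrableOn, e1]
    ring
  rw [← e2]
  refine setIntegral_nonneg measurableSet_Iic fun x hx => ?_
  exact mul_nonneg (sub_nonneg.2 hx) (gaussianPDFReal_nonneg _ _ _)

/-- The expression is the second-order tail moment `∫ (w - x)² φ(x) dx` over `x ≤ w`. Up to a
positive factor it is the derivative of `millsSlope`. -/
lemma add_sq_mul_gaussCDF_add_nonneg {v : ℝ≥0} (hv : v ≠ 0) (w : ℝ) :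
    0 ≤ (v + w ^ 2) * gaussCDF v w + v * w * gaussianPDFReal 0 v w := by
  have i0 : Integrable (gaussianPDFReal 0 v) := integrable_gaussianPDFReal 0 v
  have i1 : Integrable (fun x => gaussianPDFReal 0 v x * x) :=
    (integrable_gaussianReal_iff hv).1 (by simpa using integrable_pow_gaussianReal v 1)
  have i2 : Integrable (fun x => gaussianPDFReal 0 v x * x ^ 2) :=
    (integrable_gaussianReal_iff hv).1 (integrable_pow_gaussianReal v 2)
  have hv' : (v : ℝ) ≠ 0 := by exact_mod_cast hv
  set I : ℝ → ℝ := fun x => gaussianPDFReal 0 v x * (w - x) ^ 2 -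
    (v + w ^ 2) * gaussianPDFReal 0 v x with hI
  have iI : Integrable I := by
    have : I = fun x => (gaussianPDFReal 0 v x * x ^ 2 - (2 * w) * (gaussianPDFReal 0 v x * x)) -
        v * gaussianPDFReal 0 v x := by funext x; simp only [hI]; ring
    rw [this]
    exact (i2.sub (i1.const_mul _)).sub (i0.const_mul _)
  have hd : ∀ x, HasDerivAt (fun x => 2 * w * v * gaussianPDFReal 0 v x
      - v * (gaussianPDFReal 0 v x * x)) (I x) x := fun x =>
    (((hasDerivAt_gaussianPDFReal hv x).const_mul (2 * w * v)).sub
      (((hasDerivAt_gaussianPDFReal hv x).mul (hasDerivAt_id x)).const_mul (v : ℝ))).congr_deriv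
      (by simp only [hI, id_eq]; field_simp; ring)
  have iA : Integrable (fun x => 2 * w * v * gaussianPDFReal 0 v x
      - v * (gaussianPDFReal 0 v x * x)) := (i0.const_mul _).sub (i1.const_mul _)
  have e1 := integral_Iic_of_hasDerivAt_of_tendsto' (a := w) (fun x _ => hd x) iI.integrableOn
    (tendsto_zero_of_hasDerivAt_of_integrableOn_Iic (a := w) (fun x _ => hd x) iI.integrableOn
      iA.integrableOn)
  have e2 : ∫ x in Iic w, (I x + (v + w ^ 2) * gaussianPDFReal 0 v x) =
      (v + w ^ 2) * gaussCDF v w + v * w * gaussianPDFReal 0 v w := by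
    rw [integral_add iI.integrableOn (i0.const_mul _).integrableOn, e1, gaussCDF_eq_integral hv,
      integral_const_mul]
    ring
  rw [← e2]
  refine setIntegral_nonneg measurableSet_Iic fun x _ => ?_
  have : I x + (v + w ^ 2) * gaussianPDFReal 0 v x = gaussianPDFReal 0 v x * (w - x) ^ 2 := by
    simp only [hI]; ring
  rw [this]
  exact mul_nonneg (gaussianPDFReal_nonneg _ _ _) (sq_nonneg _)

/-- The (reflected) Mills ratio of the centred Gaussian law of variance `v`. -/
def mills (v : ℝ≥0) (w : ℝ) : ℝ := gaussCDF v w / gaussianPDFReal 0 v w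

/-- The derivative of `mills v w - w`. -/
def millsSlope (v : ℝ≥0) (w : ℝ) : ℝ := w * mills v w / v

lemma hasDerivAt_mills {v : ℝ≥0} (hv : v ≠ 0) (w : ℝ) :
    HasDerivAt (mills v) (1 + millsSlope v w) w := by
  have hp := (gaussianPDFReal_pos 0 v w hv).ne'
  have hv' : (v : ℝ) ≠ 0 := by exact_mod_cast hv
  refine ((hasDerivAt_gaussCDF hv w).div (hasDerivAt_gaussianPDFReal hv w) hp).congr_deriv ?_
  simp only [millsSlope, mills]
  field_simp
  ring

/-- `millsSlope + 1` is the tail moment `∫ (w - x) φ(x) dx` over `x ≤ w`, divided by `v φ(w)`. -/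
lemma neg_one_le_millsSlope {v : ℝ≥0} (hv : v ≠ 0) (w : ℝ) : -1 ≤ millsSlope v w := by
  have hp := gaussianPDFReal_pos 0 v w hv
  have hv' : 0 < (v : ℝ) := by positivity
  have : millsSlope v w + 1 = (w * gaussCDF v w + v * gaussianPDFReal 0 v w) /
      (v * gaussianPDFReal 0 v w) := by
    simp only [millsSlope, mills]; field_simp
  have h2 : 0 ≤ millsSlope v w + 1 := by
    rw [this]; exact div_nonneg (mul_gaussCDF_add_nonneg hv w) (by positivity)
  linarith

lemma hasDerivAt_millsSlope {v : ℝ≥0} (hv : v ≠ 0) (w : ℝ) :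
    HasDerivAt (millsSlope v) ((mills v w + w * (1 + millsSlope v w)) / v) w :=
  (((hasDerivAt_id w).mul (hasDerivAt_mills hv w)).div_const (v : ℝ)).congr_deriv (by simp)

lemma monotone_millsSlope {v : ℝ≥0} (hv : v ≠ 0) : Monotone (millsSlope v) := by
  refine monotone_of_deriv_nonneg (fun w => (hasDerivAt_millsSlope hv w).differentiableAt)
    fun w => ?_
  rw [(hasDerivAt_millsSlope hv w).deriv]
  have hp := gaussianPDFReal_pos 0 v w hv
  have hv' : 0 < (v : ℝ) := by positivity
  have : (mills v w + w * (1 + millsSlope v w)) / v =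
      ((v + w ^ 2) * gaussCDF v w + v * w * gaussianPDFReal 0 v w) /
      (v ^ 2 * gaussianPDFReal 0 v w) := by
    simp only [millsSlope, mills]; field_simp; ring
  rw [this]
  exact div_nonneg (add_sq_mul_gaussCDF_add_nonneg hv w) (by positivity)

/-- `mills v w - w` is convex. -/
lemma millsSlope_mul_le {v : ℝ≥0} (hv : v ≠ 0) (w w' : ℝ) :
    millsSlope v w * (w' - w) ≤ (mills v w' - w') - (mills v w - w) := by
  have hd : ∀ x, HasDerivAt (fun w => mills v w - w) (millsSlope v x) x := fun x =>
    ((hasDerivAt_mills hv x).sub (hasDerivAt_id x)).congr_deriv (by ring)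
  have hc : ConvexOn ℝ univ (fun w => mills v w - w) := by
    refine Monotone.convexOn_univ_of_deriv (fun x => (hd x).differentiableAt) ?_
    have : deriv (fun w => mills v w - w) = millsSlope v := funext fun x => (hd x).deriv
    rw [this]
    exact monotone_millsSlope hv
  rcases lt_trichotomy w w' with h | rfl | h
  · have := hc.le_slope_of_hasDerivAt (mem_univ w) (mem_univ w') h (hd w)
    rw [slope_def_field, le_div_iff₀ (sub_pos.2 h)] at this
    exact this
  · simp
  · have := hc.slope_le_of_hasDerivAt (mem_univ w') (mem_univ w) h (hd w)
    rw [slope_def_field, div_le_iff₀ (sub_pos.2 h)] at this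
    linarith

end MillsRatio

/-! ### Stein's equation for a half-line and its convex decomposition. -/

section SteinSolution

open Set Filter Topology

/-- The derivative of `steinConvex v t`; it is monotone. -/
def steinSlope (v : ℝ≥0) (t w : ℝ) : ℝ :=
  if w ≤ t then (1 - gaussCDF v t) * millsSlope v w else -(gaussCDF v t * millsSlope v (-w))

/-- The convex part of the solution of Stein's equation for the indicator of `(-∞, t]`. -/
def steinConvex (v : ℝ≥0) (t w : ℝ) : ℝ :=
  if w ≤ t then (1 - gaussCDF v t) * (mills v w - w) else gaussCDF v t * (mills v (-w) + w) - t

lemma steinSlope_of_le {v : ℝ≥0} {t w : ℝ} (h : w ≤ t) :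
    steinSlope v t w = (1 - gaussCDF v t) * millsSlope v w := if_pos h

lemma steinConvex_of_le {v : ℝ≥0} {t w : ℝ} (h : w ≤ t) :
    steinConvex v t w = (1 - gaussCDF v t) * (mills v w - w) := if_pos h

/-- Both sides equal `Φ(t) (1 - Φ(t)) / φ(t)`. This glues the two branches of `steinConvex` and of
`steinSlope` at `t`. -/
lemma one_sub_gaussCDF_mul_mills {v : ℝ≥0} (hv : v ≠ 0) (t : ℝ) :
    (1 - gaussCDF v t) * mills v t = gaussCDF v t * mills v (-t) := by
  rw [mills, mills, gaussCDF_neg hv, gaussianPDFReal_neg]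
  ring

lemma steinSlope_of_ge {v : ℝ≥0} (hv : v ≠ 0) {t w : ℝ} (h : t ≤ w) :
    steinSlope v t w = -(gaussCDF v t * millsSlope v (-w)) := by
  rcases h.lt_or_eq with h | rfl
  · exact if_neg (not_le.2 h)
  · rw [steinSlope_of_le le_rfl, millsSlope, millsSlope]
    linear_combination (t / v) * one_sub_gaussCDF_mul_mills hv t

lemma steinConvex_of_ge {v : ℝ≥0} (hv : v ≠ 0) {t w : ℝ} (h : t ≤ w) :
    steinConvex v t w = gaussCDF v t * (mills v (-w) + w) - t := by
  rcases h.lt_or_eq with h | rfl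
  · exact if_neg (not_le.2 h)
  · rw [steinConvex_of_le le_rfl]
    linear_combination one_sub_gaussCDF_mul_mills hv t

lemma steinSlope_le_of_le_of_le {v : ℝ≥0} (hv : v ≠ 0) {t w w' : ℝ} (h : w ≤ w') (h' : w' ≤ t) :
    steinSlope v t w ≤ steinSlope v t w' := by
  rw [steinSlope_of_le (h.trans h'), steinSlope_of_le h']
  exact mul_le_mul_of_nonneg_left (monotone_millsSlope hv h) (sub_nonneg.2 (gaussCDF_le_one v t))

lemma steinSlope_le_of_ge_of_le {v : ℝ≥0} (hv : v ≠ 0) {t w w' : ℝ} (h : w ≤ w') (h' : t ≤ w) :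
    steinSlope v t w ≤ steinSlope v t w' := by
  rw [steinSlope_of_ge hv (h'.trans h), steinSlope_of_ge hv h']
  exact neg_le_neg (mul_le_mul_of_nonneg_left (monotone_millsSlope hv (neg_le_neg h))
    (gaussCDF_nonneg v t))

lemma monotone_steinSlope {v : ℝ≥0} (hv : v ≠ 0) (t : ℝ) : Monotone (steinSlope v t) := by
  intro w w' h
  rcases le_total w' t with h1 | h1
  · exact steinSlope_le_of_le_of_le hv h h1
  rcases le_total t w with h2 | h2
  · exact steinSlope_le_of_ge_of_le hv h h2
  · exact (steinSlope_le_of_le_of_le hv h2 le_rfl).trans (steinSlope_le_of_ge_of_le hv h1 le_rfl)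

/-- Monotonicity moves the point to the left of `t`, where the bound `-1 ≤ millsSlope` applies; the
upper bound below is its mirror image. -/
lemma neg_one_sub_gaussCDF_le_steinSlope {v : ℝ≥0} (hv : v ≠ 0) (t w : ℝ) :
    -(1 - gaussCDF v t) ≤ steinSlope v t w := by
  refine le_trans ?_ (monotone_steinSlope hv t (min_le_left w t))
  rw [steinSlope_of_le (min_le_right w t)]
  nlinarith [neg_one_le_millsSlope hv (min w t), gaussCDF_le_one v t]

lemma steinSlope_le_gaussCDF {v : ℝ≥0} (hv : v ≠ 0) (t w : ℝ) :
    steinSlope v t w ≤ gaussCDF v t := by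
  refine (monotone_steinSlope hv t (le_max_left w t)).trans ?_
  rw [steinSlope_of_ge hv (le_max_right w t)]
  nlinarith [neg_one_le_millsSlope hv (-max w t), gaussCDF_nonneg v t]

lemma steinSlope_mul_le {v : ℝ≥0} (hv : v ≠ 0) (t w w' : ℝ) :
    steinSlope v t w * (w' - w) ≤ steinConvex v t w' - steinConvex v t w := by
  have hl : ∀ {w w'}, w ≤ t → w' ≤ t →
      steinSlope v t w * (w' - w) ≤ steinConvex v t w' - steinConvex v t w := by
    intro w w' h h'
    rw [steinSlope_of_le h, steinConvex_of_le h, steinConvex_of_le h']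
    nlinarith [mul_le_mul_of_nonneg_left (millsSlope_mul_le hv w w')
      (sub_nonneg.2 (gaussCDF_le_one v t))]
  have hr : ∀ {w w'}, t ≤ w → t ≤ w' →
      steinSlope v t w * (w' - w) ≤ steinConvex v t w' - steinConvex v t w := by
    intro w w' h h'
    rw [steinSlope_of_ge hv h, steinConvex_of_ge hv h, steinConvex_of_ge hv h']
    nlinarith [mul_le_mul_of_nonneg_left (millsSlope_mul_le hv (-w) (-w')) (gaussCDF_nonneg v t)]
  have hm := monotone_steinSlope hv t
  rcases le_total w t with h | h <;> rcases le_total w' t with h' | h'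
  · exact hl h h'
  -- When `t` separates the two points, add the tangent inequalities at `w` and at `t` and compare
  -- the slopes there.
  · nlinarith [hl h le_rfl, hr le_rfl h', mul_nonneg (sub_nonneg.2 (hm h)) (sub_nonneg.2 h')]
  · nlinarith [hr h le_rfl, hl le_rfl h', mul_nonneg (sub_nonneg.2 (hm h)) (sub_nonneg.2 h')]
  · exact hr h h'

lemma abs_steinConvex_sub_le {v : ℝ≥0} (hv : v ≠ 0) (t w w' : ℝ) :
    |steinConvex v t w - steinConvex v t w'| ≤ |w - w'| := by
  have key : ∀ w w', steinConvex v t w - steinConvex v t w' ≤ |w - w'| := by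
    intro w w'
    have h1 := steinSlope_mul_le hv t w w'
    have h2 : |steinSlope v t w| ≤ 1 := abs_le.2
      ⟨by linarith [neg_one_sub_gaussCDF_le_steinSlope hv t w, gaussCDF_nonneg v t],
        (steinSlope_le_gaussCDF hv t w).trans (gaussCDF_le_one v t)⟩
    calc _ ≤ steinSlope v t w * (w - w') := by linarith
      _ ≤ |steinSlope v t w| * |w - w'| := by rw [← abs_mul]; exact le_abs_self _
      _ ≤ 1 * |w - w'| := mul_le_mul_of_nonneg_right h2 (abs_nonneg _)
      _ = _ := one_mul _
  exact abs_le'.2 ⟨key w w', by rw [neg_sub, abs_sub_comm]; exact key w' w⟩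

lemma continuous_steinConvex {v : ℝ≥0} (hv : v ≠ 0) (t : ℝ) : Continuous (steinConvex v t) :=
  (LipschitzWith.of_dist_le' (K := 1) fun w w' => by
    simpa [Real.dist_eq] using abs_steinConvex_sub_le hv t w w').continuous

lemma abs_steinConvex_le {v : ℝ≥0} (hv : v ≠ 0) (t w : ℝ) :
    |steinConvex v t w| ≤ |steinConvex v t 0| + |w| := by
  have h := abs_steinConvex_sub_le hv t w 0
  rw [sub_zero] at h
  linarith [abs_sub_abs_le_abs_sub (steinConvex v t w) (steinConvex v t 0)]

lemma hasDerivAt_steinConvex {v : ℝ≥0} (hv : v ≠ 0) {t w : ℝ} (hw : w ≠ t) :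
    HasDerivAt (steinConvex v t) (steinSlope v t w) w := by
  rcases hw.lt_or_gt with h | h
  · rw [steinSlope_of_le h.le]
    refine HasDerivAt.congr_of_eventuallyEq
      ((((hasDerivAt_mills hv w).sub (hasDerivAt_id w)).const_mul
        (1 - gaussCDF v t)).congr_deriv (by ring)) ?_
    filter_upwards [Iio_mem_nhds h] with x hx using steinConvex_of_le (le_of_lt hx)
  · rw [steinSlope_of_ge hv h.le]
    have hneg : HasDerivAt (fun x => mills v (-x)) (-(1 + millsSlope v (-w))) w := by
      exact ((hasDerivAt_mills hv (-w)).comp w (hasDerivAt_neg w)).congr_deriv (by ring)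
    refine HasDerivAt.congr_of_eventuallyEq
      (((hneg.add (hasDerivAt_id w)).const_mul (gaussCDF v t)).sub_const t |>.congr_deriv
        (by ring)) ?_
    filter_upwards [Ioi_mem_nhds h] with x hx using steinConvex_of_ge hv (le_of_lt hx)

/-- The solution of Stein's equation `v F' (w) - w F (w) = 1_{w ≤ t} - Φ(t)` is, up to a
linear term, a difference of two convex functions, which controls its first-order Taylor
remainder. -/
theorem exists_stein_solution {v : ℝ≥0} (hv : v ≠ 0) (t : ℝ) :
    ∃ (F F' Ψ ψ : ℝ → ℝ) (C m : ℝ), Continuous F ∧ Measurable F' ∧ Continuous Ψ ∧ Measurable ψ ∧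
      (∀ w ≠ t, HasDerivAt F (F' w) w) ∧
      (∀ w, v * F' w - w * F w =
        (Iic t).indicator 1 w - (gaussianReal 0 v).real (Iic t)) ∧
      (∀ w, |F' w| ≤ 1 / v) ∧ (∀ w, |ψ w - m| ≤ 1 / v) ∧
      (∀ w, |F w| ≤ C * (1 + |w|)) ∧ (∀ w, |Ψ w| ≤ C * (1 + |w|)) ∧
      (∀ w w', |F w - F w' - F' w * (w - w')| ≤ Ψ w' - Ψ w + ψ w * (w - w')) := by
  have hv0 : (0 : ℝ) < v := by positivity
  set c := gaussCDF v t with hc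
  have hc0 : 0 ≤ c := gaussCDF_nonneg v t
  have hc1 : c ≤ 1 := gaussCDF_le_one v t
  set H := steinConvex v t with hH
  set h := steinSlope v t with hh
  have hlo : ∀ w, -(1 - c) ≤ h w := neg_one_sub_gaussCDF_le_steinSlope hv t
  have hup : ∀ w, h w ≤ c := steinSlope_le_gaussCDF hv t
  have hHc : Continuous H := continuous_steinConvex hv t
  have hhm : Measurable h := (monotone_steinSlope hv t).measurable
  set e : ℝ → ℝ := (Ioi t).indicator 1 with he
  have hem : Measurable e := measurable_one.indicator measurableSet_Ioi
  set p : ℝ → ℝ := fun w => max (w - t) 0 with hp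
  have hpc : Continuous p := by fun_prop
  have hgt : ∀ {w}, t < w → e w = 1 ∧ p w = w - t := fun {w} hw =>
    ⟨by simp [he, hw], max_eq_left (by linarith)⟩
  have hle : ∀ {w}, w ≤ t → e w = 0 ∧ p w = 0 := fun {w} hw =>
    ⟨by simp [he, hw], max_eq_right (by linarith)⟩
  have hpconv : ∀ w w', e w * (w' - w) ≤ p w' - p w := by
    intro w w'
    rcases le_or_gt w t with h1 | h1
    · rw [(hle h1).1, (hle h1).2]; simp [hp]
    · rw [(hgt h1).1, (hgt h1).2]; linarith [le_max_left (w' - t) 0]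
  have hpl : ∀ w, |p w| ≤ |t| + |w| := fun w => by
    rcases le_or_gt w t with h1 | h1
    · rw [(hle h1).2, abs_zero]; positivity
    · rw [(hgt h1).2]; linarith [abs_sub w t]
  have hHl : ∀ w, |H w| ≤ |H 0| + |w| := abs_steinConvex_le hv t
  -- `H w + (1 - c) w - p w` is the classical solution multiplied by `v`: `(1 - c) * mills v w` on
  -- the left of `t` and `c * mills v (-w)` on the right.
  have key : ∀ w, w * (H w + (1 - c) * w - p w) = v * h w := by
    intro w
    rcases le_or_gt w t with h1 | h1
    · rw [(hle h1).2, hH, hh, steinConvex_of_le h1, steinSlope_of_le h1, millsSlope]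
      field_simp; ring
    · rw [(hgt h1).2, hH, hh, steinConvex_of_ge hv h1.le, steinSlope_of_ge hv h1.le, millsSlope]
      field_simp; ring
  have habs : ∀ x : ℝ, |x| ≤ 1 → |x / v| ≤ 1 / v := fun x hx => by
    rw [abs_div, abs_of_pos hv0]; gcongr
  refine ⟨fun w => (H w + (1 - c) * w - p w) / v, fun w => (h w + (1 - c) - e w) / v,
    fun w => (H w + p w) / v, fun w => (h w + e w) / v, (|H 0| + |t| + 3) / v, c / v,
    by fun_prop, by fun_prop, by fun_prop, by fun_prop, ?_, ?_, ?_, ?_, ?_, ?_, ?_⟩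
  · intro w hw
    have hpd : HasDerivAt p (e w) w := by
      rcases hw.lt_or_gt with h1 | h1
      · rw [(hle h1.le).1]
        refine (hasDerivAt_const w (0 : ℝ)).congr_of_eventuallyEq ?_
        filter_upwards [Iio_mem_nhds h1] with x hx using (hle (le_of_lt hx)).2
      · rw [(hgt h1).1]
        refine ((hasDerivAt_id w).sub_const t).congr_of_eventuallyEq ?_
        filter_upwards [Ioi_mem_nhds h1] with x hx using (hgt hx).2
    exact ((((hasDerivAt_steinConvex hv hw).add ((hasDerivAt_id w).const_mul (1 - c))).sub
      hpd).div_const (v : ℝ)).congr_deriv (by simp [hh])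
  · intro w
    have hk := key w
    have hi : (Iic t).indicator 1 w = 1 - e w := by
      rcases le_or_gt w t with h1 | h1
      · simp [(hle h1).1, h1]
      · simp [(hgt h1).1, h1]
    rw [hi, ← gaussCDF, ← hc]
    simp only
    rw [mul_div_assoc', mul_div_assoc', hk]
    field_simp; ring
  · intro w
    refine habs _ (abs_le.2 ?_)
    have := hlo w
    have := hup w
    rcases le_or_gt w t with h1 | h1
    · rw [(hle h1).1]; constructor <;> linarith
    · rw [(hgt h1).1]; constructor <;> linarith
  -- Since `-(1 - c) ≤ h ≤ c`, the sum `h + e - c` lies in `[-1, 0]` up to `t` and in `[0, 1]` after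
  -- it. Subtracting `m = c / v` therefore halves the bound that the jump of `e` would cost.
  · intro w
    rw [← sub_div]
    refine habs _ (abs_le.2 ?_)
    have := hlo w
    have := hup w
    rcases le_or_gt w t with h1 | h1
    · rw [(hle h1).1]; constructor <;> linarith
    · rw [(hgt h1).1]; constructor <;> linarith
  · intro w
    rw [abs_div, abs_of_pos hv0, div_mul_eq_mul_div]
    gcongr
    have h3 : |(1 - c) * w| ≤ |w| := by
      rw [abs_mul, abs_of_nonneg (by linarith : 0 ≤ 1 - c)]
      nlinarith [abs_nonneg w]
    calc |H w + (1 - c) * w - p w| ≤ |H w| + |(1 - c) * w| + |p w| := by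
          linarith [abs_sub (H w + (1 - c) * w) (p w), abs_add_le (H w) ((1 - c) * w)]
      _ ≤ |H 0| + |t| + 3 * |w| := by linarith [hHl w, hpl w]
      _ ≤ _ := by nlinarith [abs_nonneg w, abs_nonneg (H 0), abs_nonneg t]
  · intro w
    rw [abs_div, abs_of_pos hv0, div_mul_eq_mul_div]
    gcongr
    calc |H w + p w| ≤ |H w| + |p w| := abs_add_le _ _
      _ ≤ |H 0| + |t| + 2 * |w| := by linarith [hHl w, hpl w]
      _ ≤ _ := by nlinarith [abs_nonneg w, abs_nonneg (H 0), abs_nonneg t]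
  · intro w w'
    -- Let `D_H, D_p ≥ 0` be the convexity gaps of `H` and `p`. The linear part of `F` drops out of
    -- the remainder, which is `(D_p - D_H) / v`, while the right-hand side is `(D_H + D_p) / v`.
    have h1 := steinSlope_mul_le hv t w w'
    have h2 := hpconv w w'
    rw [← sub_div, ← sub_div, div_mul_eq_mul_div, div_mul_eq_mul_div, ← sub_div, ← add_div,
      abs_div, abs_of_pos hv0]
    gcongr
    rw [abs_le]
    constructor <;> simp only [← hH, ← hh] at h1 <;> nlinarith

end SteinSolution

/-! ### Absorbing the additive Gaussian noise. -/

section SmoothedStein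

open Set

/-- The Stein equation for `N(0, K)` averaged over an additive Gaussian noise of variance `c`. -/
theorem exists_smoothed_stein_solution (c : ℝ≥0) {K : ℝ≥0} (hK : K ≠ 0) (t : ℝ) :
    ∃ (g g' Ψ ψ : ℝ → ℝ) (C m : ℝ), Measurable g ∧ Measurable g' ∧ Measurable Ψ ∧ Measurable ψ ∧
      (∀ y, ((K : ℝ) - c) * g' y - y * g y =
        (gaussianReal 0 c).real (Iic (t - y)) - (gaussianReal 0 K).real (Iic t)) ∧
      (∀ y, |g' y| ≤ 1 / K) ∧ (∀ y, |ψ y - m| ≤ 1 / K) ∧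
      (∀ y, |g y| ≤ C * (1 + |y|)) ∧ (∀ y, |Ψ y| ≤ C * (1 + |y|)) ∧
      (∀ y y', |g y - g y' - g' y * (y - y')| ≤ Ψ y' - Ψ y + ψ y * (y - y')) := by
  obtain ⟨F, F', Ψ, ψ, C, m, hF, hF', hΨ, hψ, hd, hst, hF'b, hψb, hFl, hΨl, hin⟩ :=
    exists_stein_solution hK t
  set ν := gaussianReal 0 c with hν
  have hC : 0 ≤ C := by have := (abs_nonneg _).trans (hFl 0); simpa using this
  have i1 : Integrable (fun x : ℝ => |x|) ν := by
    simpa using (integrable_pow_gaussianReal c 1).abs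
  have i0 : Integrable (fun _ : ℝ => (1 : ℝ)) ν := integrable_const 1
  have hbb : ∀ b y : ℝ, 1 + |b + y| ≤ (1 + |b|) * (1 + |y|) := fun b y => by
    nlinarith [abs_add_le b y, mul_nonneg (abs_nonneg b) (abs_nonneg y)]
  have hdom : ∀ y, Integrable (fun b => C * ((1 + |b|) * (1 + |y|))) ν := fun y =>
    ((i0.add i1).mul_const (1 + |y|)).const_mul C
  have hlin : ∀ {u : ℝ → ℝ}, Continuous u → (∀ w, |u w| ≤ C * (1 + |w|)) →
      ∀ y, Integrable (fun b => u (b + y)) ν ∧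
        |∫ b, u (b + y) ∂ν| ≤ C * (1 + ∫ b, |b| ∂ν) * (1 + |y|) := by
    intro u hu hul y
    have hle : ∀ b, ‖u (b + y)‖ ≤ C * ((1 + |b|) * (1 + |y|)) := fun b =>
      (hul _).trans (mul_le_mul_of_nonneg_left (hbb b y) hC)
    refine ⟨(hdom y).mono' (by fun_prop) (ae_of_all _ hle), ?_⟩
    have := norm_integral_le_of_norm_le (hdom y) (ae_of_all _ hle)
    rw [integral_const_mul, integral_mul_const, integral_add i0 i1] at this
    simpa [mul_assoc] using this
  have hbdd : ∀ {u : ℝ → ℝ} {m : ℝ}, Measurable u → (∀ w, |u w - m| ≤ 1 / K) →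
      ∀ y, Integrable (fun b => u (b + y)) ν ∧ |(∫ b, u (b + y) ∂ν) - m| ≤ 1 / K := by
    intro u m hu hub y
    have hi : Integrable (fun b => u (b + y) - m) ν :=
      Integrable.of_bound
        ((hu.comp (measurable_id.add_const y)).sub_const m).aestronglyMeasurable
        (1 / K) (ae_of_all _ fun b => hub _)
    have hi' : Integrable (fun b => u (b + y)) ν :=
      (hi.add (integrable_const m)).congr (ae_of_all _ fun b => by simp)
    refine ⟨hi', ?_⟩
    have := norm_integral_le_of_norm_le_const (μ := ν) (f := fun b => u (b + y) - m)
      (ae_of_all _ fun b => hub (b + y))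
    rw [integral_sub hi' (integrable_const m)] at this
    simpa using this
  have hmeas : ∀ {u : ℝ → ℝ}, Measurable u → Measurable fun y => ∫ b, u (b + y) ∂ν := by
    intro u hu
    have : Measurable (Function.uncurry fun y b : ℝ => u (b + y)) := by fun_prop
    exact this.stronglyMeasurable.integral_prod_right.measurable
  have hF'b0 : ∀ w, |F' w - 0| ≤ 1 / K := by simpa using hF'b
  refine ⟨fun y => ∫ b, F (b + y) ∂ν, fun y => ∫ b, F' (b + y) ∂ν, fun y => ∫ b, Ψ (b + y) ∂ν,
    fun y => ∫ b, ψ (b + y) ∂ν, C * (1 + ∫ b, |b| ∂ν), m, hmeas hF.measurable, hmeas hF',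
    hmeas hΨ.measurable, hmeas hψ, fun y => ?_, fun y => ?_, fun y => (hbdd hψ hψb y).2,
    fun y => (hlin hF hFl y).2, fun y => (hlin hΨ hΨl y).2, fun y y' => ?_⟩
  · have hibp : ∫ b, b * F (b + y) ∂ν = c * ∫ b, F' (b + y) ∂ν := by
      refine integral_id_mul_gaussianReal (a := t - y)
        (C := max (C * (1 + |y|)) (1 / K)) (by fun_prop) (fun x hx => ?_) (by fun_prop)
        (fun x => ?_) (fun x => (hF'b _).trans (le_max_right _ _))
      · have h := hd (x + y) (fun h => hx (by linarith))
        exact HasDerivAt.comp_add_const x y h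
      · refine (hFl _).trans ?_
        calc C * (1 + |x + y|) ≤ C * ((1 + |x|) * (1 + |y|)) :=
              mul_le_mul_of_nonneg_left (hbb x y) hC
          _ = C * (1 + |y|) * (1 + |x|) := by ring
          _ ≤ _ := mul_le_mul_of_nonneg_right (le_max_left _ _) (by positivity)
    have iF := (hlin hF hFl y).1
    have iF' := (hbdd hF' hF'b0 y).1
    have ii : Integrable (fun b => (Iic t).indicator 1 (b + y) : ℝ → ℝ) ν :=
      Integrable.of_bound (C := 1) (by
        have : Measurable ((Iic t).indicator (1 : ℝ → ℝ)) :=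
          measurable_one.indicator measurableSet_Iic
        exact (this.comp (measurable_id.add_const y)).aestronglyMeasurable)
        (ae_of_all _ fun b => by
          by_cases h : b + y ≤ t <;> simp [h])
    have ibF : Integrable (fun b => b * F (b + y)) ν := by
      have : (fun b => b * F (b + y)) = fun b => K * F' (b + y) - y * F (b + y) -
          ((Iic t).indicator 1 (b + y) - (gaussianReal 0 K).real (Iic t)) := by
        funext b; rw [← hst]; ring
      rw [this]
      exact ((iF'.const_mul _).sub (iF.const_mul _)).sub (ii.sub (integrable_const _))
    have hs : ∫ b, (Iic t).indicator 1 (b + y) ∂ν = ν.real (Iic (t - y)) := by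
      have : (fun b => (Iic t).indicator (1 : ℝ → ℝ) (b + y)) = (Iic (t - y)).indicator 1 := by
        funext b
        simp [indicator, le_sub_iff_add_le]
      rw [this, integral_indicator_one measurableSet_Iic]
    have e : ∫ b, ((Iic t).indicator 1 (b + y) - (gaussianReal 0 K).real (Iic t)) ∂ν =
        ∫ b, (K * F' (b + y) - (b * F (b + y) + y * F (b + y))) ∂ν := by
      refine integral_congr_ae (ae_of_all _ fun b => ?_)
      simp only
      rw [← hst]; ring
    have i3 : Integrable (fun b => b * F (b + y) + y * F (b + y)) ν := ibF.add (iF.const_mul _)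
    rw [integral_sub ii (integrable_const _), integral_sub (iF'.const_mul _) i3, integral_add ibF (iF.const_mul _), integral_const_mul,
      integral_const_mul, hibp, hs, integral_const] at e
    simp only [probReal_univ, one_smul] at e
    simp only
    linarith
  · simpa using (hbdd hF' hF'b0 y).2
  · have iF := (hlin hF hFl y).1
    have iF2 := (hlin hF hFl y').1
    have iF' := (hbdd hF' hF'b0 y).1
    have iΨ := (hlin hΨ hΨl y).1
    have iΨ' := (hlin hΨ hΨl y').1
    have iψ := (hbdd hψ hψb y).1
    have i3 : Integrable (fun b => F (b + y) - F (b + y')) ν := iF.sub iF2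
    have i4 : Integrable (fun b => Ψ (b + y') - Ψ (b + y)) ν := iΨ'.sub iΨ
    simp only
    rw [← integral_sub iF iF2, ← integral_mul_const, ← integral_sub i3 (iF'.mul_const _),
      ← integral_sub iΨ' iΨ, ← integral_mul_const, ← integral_add i4 (iψ.mul_const _)]
    refine norm_integral_le_of_norm_le
      (f := fun b => F (b + y) - F (b + y') - F' (b + y) * (y - y')) (i4.add (iψ.mul_const _))
      (ae_of_all _ fun b => ?_)
    simpa using hin (b + y) (b + y')

end SmoothedStein

/-! ### Combinatorics and symmetry of resampled vectors. -/

section ResamplingIdentities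

variable {E : Type*} {k : ℕ}

/-- The weights in `steinT` telescope. -/
lemma sum_resample_telescope (a : Finset (Fin k) → ℝ) :
    ∑ A ∈ (Finset.univ : Finset (Fin k)).ssubsets,
      1 / ((k.choose A.card : ℝ) * ((k : ℝ) - (A.card : ℝ))) *
        ∑ j ∈ Aᶜ, (a A - a (insert j A)) = a ∅ - a Finset.univ := by
  classical
  set κ : Finset (Fin k) → ℝ :=
    fun A => 1 / ((k.choose A.card : ℝ) * ((k : ℝ) - (A.card : ℝ))) with hκ
  -- Each set `B` is left with total weight `(k - |B|) κ(B) = 1 / C(k,|B|)` and entered with total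
  -- weight `|B| κ(B \ {j})`, which has the same value. Only `∅` (never entered) and `[k]` (never
  -- left) survive.
  set c : Finset (Fin k) → ℝ := fun A => a A / (k.choose A.card : ℝ) with hc
  have hcard : ∀ A : Finset (Fin k), A.card ≤ k := fun A => by
    simpa using Finset.card_le_univ A
  have hss : (Finset.univ : Finset (Fin k)).ssubsets = Finset.univ.erase Finset.univ := by
    ext A; simp [Finset.ssubset_univ_iff]
  have h1 : ∑ A ∈ (Finset.univ : Finset (Fin k)).ssubsets, κ A * ∑ j ∈ Aᶜ, a A =
      ∑ A, c A - c Finset.univ := by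
    rw [hss, ← Finset.sum_erase_eq_sub (Finset.mem_univ _)]
    refine Finset.sum_congr rfl fun A hA => ?_
    have hlt : A.card < k := lt_of_le_of_ne (hcard A) fun h =>
      Finset.ne_of_mem_erase hA ((Finset.card_eq_iff_eq_univ A).1 (by simpa using h))
    have h3 : (k : ℝ) - A.card ≠ 0 := by
      have : (A.card : ℝ) < k := by exact_mod_cast hlt
      linarith
    have h4 : (k.choose A.card : ℝ) ≠ 0 := by exact_mod_cast (Nat.choose_pos hlt.le).ne'
    rw [Finset.sum_const, Finset.card_compl, Fintype.card_fin, nsmul_eq_mul,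
      Nat.cast_sub (hcard A)]
    simp only [hκ, hc]
    field_simp
  have h2 : ∑ A ∈ (Finset.univ : Finset (Fin k)).ssubsets, κ A * ∑ j ∈ Aᶜ, a (insert j A) =
      ∑ A, c A - c ∅ := by
    have e1 : ∑ A ∈ (Finset.univ : Finset (Fin k)).ssubsets, κ A * ∑ j ∈ Aᶜ, a (insert j A) =
        ∑ A : Finset (Fin k), ∑ j ∈ Aᶜ, κ A * a (insert j A) := by
      rw [hss, ← Finset.add_sum_erase Finset.univ _ (Finset.mem_univ (Finset.univ))]
      simp [Finset.mul_sum]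
    -- Reindex the pairs `j ∉ A` by `B = A ∪ {j}` with the marked element `j ∈ B`.
    have e2 : ∑ A : Finset (Fin k), ∑ j ∈ Aᶜ, κ A * a (insert j A) =
        ∑ B : Finset (Fin k), ∑ j ∈ B, κ (B.erase j) * a B := by
      rw [Finset.sum_sigma', Finset.sum_sigma']
      refine Finset.sum_bij' (fun p _ => ⟨insert p.2 p.1, p.2⟩) (fun p _ => ⟨p.1.erase p.2, p.2⟩)
        ?_ ?_ ?_ ?_ ?_
      · simp
      · simp
      · rintro ⟨A, j⟩ h
        have : j ∉ A := by simpa using h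
        simp [Finset.erase_insert this]
      · rintro ⟨A, j⟩ h
        have : j ∈ A := by simpa using h
        simp [Finset.insert_erase this]
      · rintro ⟨A, j⟩ h
        have : j ∉ A := by simpa using h
        simp [Finset.erase_insert this]
    rw [e1, e2, ← Finset.sum_erase_eq_sub (Finset.mem_univ _),
      ← Finset.add_sum_erase Finset.univ _ (Finset.mem_univ (∅ : Finset (Fin k)))]
    simp only [Finset.sum_empty, zero_add]
    refine Finset.sum_congr rfl fun B hB => ?_
    have hne : B.Nonempty := Finset.nonempty_iff_ne_empty.2 (Finset.ne_of_mem_erase hB)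
    obtain ⟨n, hn⟩ : ∃ n, B.card = n + 1 := ⟨B.card - 1, by have := hne.card_pos; omega⟩
    have hnk : n + 1 ≤ k := hn ▸ hcard B
    have h3 : (k.choose (n + 1) : ℝ) * (n + 1) = k.choose n * ((k : ℝ) - n) := by
      have := Nat.choose_succ_right_eq k n
      rw [← Nat.cast_sub (by omega : n ≤ k)]
      exact_mod_cast this
    have h4 : (k.choose (n + 1) : ℝ) ≠ 0 := by exact_mod_cast (Nat.choose_pos hnk).ne'
    have h5 : (n + 1 : ℝ) ≠ 0 := by positivity
    rw [Finset.sum_congr rfl (g := fun _ => 1 / ((k.choose (n + 1) : ℝ) * (n + 1)) * a B)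
      fun j hj => by simp only [hκ, Finset.card_erase_of_mem hj, hn, Nat.add_sub_cancel, h3]]
    rw [Finset.sum_const, hn, nsmul_eq_mul]
    simp only [hc, hn]
    push_cast
    field_simp
  calc _ = ∑ A ∈ (Finset.univ : Finset (Fin k)).ssubsets, κ A * ∑ j ∈ Aᶜ, a A -
        ∑ A ∈ (Finset.univ : Finset (Fin k)).ssubsets, κ A * ∑ j ∈ Aᶜ, a (insert j A) := by
        rw [← Finset.sum_sub_distrib]
        exact Finset.sum_congr rfl fun A _ => by rw [Finset.sum_sub_distrib, mul_sub]
    _ = _ := by rw [h1, h2]; simp [hc]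

lemma resample_weight_nonneg (A : Finset (Fin k)) :
    0 ≤ 1 / ((k.choose A.card : ℝ) * ((k : ℝ) - (A.card : ℝ))) := by
  have : (A.card : ℝ) ≤ k := by exact_mod_cast (by simpa using Finset.card_le_univ A)
  exact one_div_nonneg.2 (mul_nonneg (Nat.cast_nonneg _) (sub_nonneg.2 this))

@[simp]
lemma resample_empty (x x' : Fin k → E) : resample x x' ∅ = x := by
  funext i; simp [resample]

@[simp]
lemma resample_univ (x x' : Fin k → E) : resample x x' Finset.univ = x' := by
  funext i; simp [resample]

/-- Exchange the coordinates in `A` of two vectors. -/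
def swapOn (A : Finset (Fin k)) (p : (Fin k → E) × (Fin k → E)) : (Fin k → E) × (Fin k → E) :=
  (resample p.1 p.2 A, resample p.2 p.1 A)

lemma resample_swapOn {A : Finset (Fin k)} {j : Fin k} (hj : j ∉ A)
    (p : (Fin k → E) × (Fin k → E)) :
    resample (swapOn {j} p).1 (swapOn {j} p).2 A = resample p.1 p.2 (insert j A) := by
  funext i
  rcases eq_or_ne i j with rfl | h <;> simp [swapOn, resample, *]

lemma resample_swapOn_insert {A : Finset (Fin k)} {j : Fin k} (hj : j ∉ A)
    (p : (Fin k → E) × (Fin k → E)) :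
    resample (swapOn {j} p).1 (swapOn {j} p).2 (insert j A) = resample p.1 p.2 A := by
  funext i
  rcases eq_or_ne i j with rfl | h <;> simp [swapOn, resample, *]

variable [MeasurableSpace E]

lemma measurable_resample (A : Finset (Fin k)) :
    Measurable fun p : (Fin k → E) × (Fin k → E) => resample p.1 p.2 A := by
  refine measurable_pi_iff.2 fun i => ?_
  by_cases h : i ∈ A
  · simp only [resample, h, if_true]; fun_prop
  · simp only [resample, h, if_false]; fun_prop

variable (μ : Fin k → Measure E) [∀ i, IsProbabilityMeasure (μ i)]

/-- Regrouped as a vector of pairs `(x_i, x'_i)`, the law is a product of the symmetric measures `μ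
i ⊗ μ i`, and the exchange acts coordinate by coordinate. -/
lemma measurePreserving_swapOn (A : Finset (Fin k)) :
    MeasurePreserving (swapOn A) ((Measure.pi μ).prod (Measure.pi μ))
      ((Measure.pi μ).prod (Measure.pi μ)) := by
  classical
  have he := measurePreserving_arrowProdEquivProdArrow E E (Fin k) μ μ
  have hs : MeasurePreserving
      (fun (a : Fin k → E × E) i => (if i ∈ A then Prod.swap else id) (a i))
      (.pi fun i => (μ i).prod (μ i)) (.pi fun i => (μ i).prod (μ i)) := by
    refine measurePreserving_pi _ _ (f := fun i => if i ∈ A then Prod.swap else id) fun i => ?_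
    split_ifs
    · exact Measure.measurePreserving_swap
    · exact MeasurePreserving.id _
  have := (he.comp hs).comp (he.symm _)
  convert this using 1
  funext p
  ext i <;>
  · by_cases h : i ∈ A <;>
    simp [swapOn, resample, MeasurableEquiv.arrowProdEquivProdArrow,
      Equiv.arrowProdEquivProdArrow, h]

lemma measurePreserving_resample (A : Finset (Fin k)) :
    MeasurePreserving (fun p : (Fin k → E) × (Fin k → E) => resample p.1 p.2 A)
      ((Measure.pi μ).prod (Measure.pi μ)) (Measure.pi μ) :=
  measurePreserving_fst.comp (measurePreserving_swapOn μ A)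

end ResamplingIdentities

/-! ### Chatterjee's identity and the normal approximation bound. -/

section ResamplingBound

variable {E : Type*} {k : ℕ}

/-- The weighted sum over `A ⊊ [k]` and `j ∉ A` which appears in `steinT` and `steinT'`. -/
def resampleSum (a : Finset (Fin k) → Fin k → ℝ) : ℝ :=
  ∑ A ∈ (Finset.univ : Finset (Fin k)).ssubsets,
    1 / ((k.choose A.card : ℝ) * ((k : ℝ) - (A.card : ℝ))) * ∑ j ∈ Aᶜ, a A j

lemma resampleSum_mono {a a' : Finset (Fin k) → Fin k → ℝ} (h : ∀ A, ∀ j ∉ A, a A j ≤ a' A j) :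
    resampleSum a ≤ resampleSum a' :=
  Finset.sum_le_sum fun A _ => mul_le_mul_of_nonneg_left
    (Finset.sum_le_sum fun j hj => h A j (Finset.mem_compl.1 hj)) (resample_weight_nonneg A)

lemma resampleSum_congr {a a' : Finset (Fin k) → Fin k → ℝ} (h : ∀ A, ∀ j ∉ A, a A j = a' A j) :
    resampleSum a = resampleSum a' :=
  le_antisymm (resampleSum_mono fun A j hj => (h A j hj).le)
    (resampleSum_mono fun A j hj => (h A j hj).ge)

lemma resampleSum_sub (a a' : Finset (Fin k) → Fin k → ℝ) :
    resampleSum (fun A j => a A j - a' A j) = resampleSum a - resampleSum a' := by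
  simp only [resampleSum, Finset.sum_sub_distrib, mul_sub]

lemma mul_resampleSum (c : ℝ) (a : Finset (Fin k) → Fin k → ℝ) :
    c * resampleSum a = resampleSum fun A j => c * a A j := by
  simp only [resampleSum, Finset.mul_sum, mul_left_comm c]

lemma abs_resampleSum_le (a : Finset (Fin k) → Fin k → ℝ) :
    |resampleSum a| ≤ resampleSum fun A j => |a A j| := by
  have h := mul_resampleSum (-1) a
  refine abs_le.2 ⟨?_, resampleSum_mono fun A j _ => le_abs_self _⟩
  have : resampleSum (fun A j => -1 * a A j) ≤ resampleSum fun A j => |a A j| :=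
    resampleSum_mono fun A j _ => by rw [neg_one_mul]; exact neg_le_abs _
  linarith

/-- The weights sum up to one for every `j`. -/
lemma resampleSum_const (c : Fin k → ℝ) : resampleSum (fun _ j => c j) = ∑ j, c j := by
  -- For the additive set function `A ↦ -∑ j ∈ A, c j`, the increment at `(A, j)` is `c j`,
  -- independently of `A`.
  have h := sum_resample_telescope (k := k) fun A => -∑ j ∈ A, c j
  rw [Finset.sum_empty] at h
  rw [show ∑ j, c j = -0 - -∑ j, c j by ring, ← h]
  refine Finset.sum_congr rfl fun A _ => ?_
  congr 1
  refine Finset.sum_congr rfl fun j hj => ?_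
  rw [Finset.sum_insert (Finset.mem_compl.1 hj)]
  ring

lemma integral_resampleSum {Ω : Type*} [MeasurableSpace Ω] {P : Measure Ω}
    {a : Finset (Fin k) → Fin k → Ω → ℝ} (h : ∀ A j, Integrable (a A j) P) :
    ∫ ω, resampleSum (fun A j => a A j ω) ∂P = resampleSum fun A j => ∫ ω, a A j ω ∂P := by
  simp only [resampleSum]
  rw [integral_finsetSum _ fun A _ => (integrable_finsetSum _ fun j _ => h A j).const_mul _]
  refine Finset.sum_congr rfl fun A _ => ?_
  rw [integral_const_mul, integral_finsetSum _ fun j _ => h A j]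

lemma integrable_resampleSum {Ω : Type*} [MeasurableSpace Ω] {P : Measure Ω}
    {a : Finset (Fin k) → Fin k → Ω → ℝ} (h : ∀ A j, Integrable (a A j) P) :
    Integrable (fun ω => resampleSum fun A j => a A j ω) P :=
  integrable_finsetSum _ fun A _ => (integrable_finsetSum _ fun j _ => h A j).const_mul _

lemma steinT_eq_resampleSum (f : (Fin k → E) → ℝ) (x x' : Fin k → E) :
    steinT f x x' =
      1 / 2 * resampleSum fun A j => resampleDiff f j ∅ x x' * resampleDiff f j A x x' := rfl

lemma steinT'_eq_resampleSum (f : (Fin k → E) → ℝ) (x x' : Fin k → E) :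
    steinT' f x x' =
      1 / 2 * resampleSum fun A j => resampleDiff f j ∅ x x' * |resampleDiff f j A x x'| := rfl

/-- Exchanging `x_j` and `x'_j` interchanges `X^A` and `X^{A ∪ {j}}`; this is the antisymmetry on
which the whole bound rests. -/
lemma resampleDiff_swapOn (f : (Fin k → E) → ℝ) {A : Finset (Fin k)} {j : Fin k} (hj : j ∉ A)
    (p : (Fin k → E) × (Fin k → E)) :
    resampleDiff f j A (swapOn {j} p).1 (swapOn {j} p).2 = -resampleDiff f j A p.1 p.2 := by
  rw [resampleDiff, resampleDiff, resample_swapOn hj, resample_swapOn_insert hj]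
  ring

variable [MeasurableSpace E] (μ : Fin k → Measure E) [∀ i, IsProbabilityMeasure (μ i)]

lemma integral_comp_swapOn {A : Finset (Fin k)} {G : (Fin k → E) × (Fin k → E) → ℝ}
    (hG : AEStronglyMeasurable G ((Measure.pi μ).prod (Measure.pi μ))) :
    ∫ p, G (swapOn A p) ∂(Measure.pi μ).prod (Measure.pi μ) =
      ∫ p, G p ∂(Measure.pi μ).prod (Measure.pi μ) := by
  have h := measurePreserving_swapOn μ A
  conv_rhs => rw [← h.map_eq]
  rw [integral_map h.measurable.aemeasurable (by rwa [h.map_eq])]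

/-- A change of variables by the exchange of coordinate `j`. It is used with `s = -1` for increments
and `s = 1` for their absolute values. -/
lemma integral_resample_mul {u : (Fin k → E) → ℝ} (hu : Measurable u)
    {V : (Fin k → E) × (Fin k → E) → ℝ} (hV : Measurable V) {s : ℝ} {j : Fin k}
    (hs : ∀ p, V (swapOn {j} p) = s * V p) :
    s * ∫ p, u (resample p.1 p.2 {j}) * V p ∂(Measure.pi μ).prod (Measure.pi μ) =
      ∫ p, u p.1 * V p ∂(Measure.pi μ).prod (Measure.pi μ) := by
  rw [← integral_comp_swapOn μ (A := {j}) (G := fun p => u p.1 * V p)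
    ((hu.comp measurable_fst).mul hV).aestronglyMeasurable, ← integral_const_mul]
  refine integral_congr_ae (ae_of_all _ fun p => ?_)
  simp only [hs]
  simp only [swapOn]
  ring

lemma memLp_comp_resample {p : ENNReal} {f : (Fin k → E) → ℝ} (hf : MemLp f p (Measure.pi μ))
    (A : Finset (Fin k)) :
    MemLp (fun p : (Fin k → E) × (Fin k → E) => f (resample p.1 p.2 A)) p
      ((Measure.pi μ).prod (Measure.pi μ)) :=
  hf.comp_measurePreserving (measurePreserving_resample μ A)

lemma memLp_resampleDiff {p : ENNReal} {f : (Fin k → E) → ℝ} (hf : MemLp f p (Measure.pi μ))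
    (j : Fin k) (A : Finset (Fin k)) :
    MemLp (fun p : (Fin k → E) × (Fin k → E) => resampleDiff f j A p.1 p.2) p
      ((Measure.pi μ).prod (Measure.pi μ)) :=
  (memLp_comp_resample μ hf A).sub (memLp_comp_resample μ hf (insert j A))

lemma measurable_resampleDiff {f : (Fin k → E) → ℝ} (hf : Measurable f) (j : Fin k)
    (A : Finset (Fin k)) :
    Measurable fun p : (Fin k → E) × (Fin k → E) => resampleDiff f j A p.1 p.2 :=
  (hf.comp (measurable_resample A)).sub (hf.comp (measurable_resample (insert j A)))

lemma memLp_comp_of_abs_le {Ω : Type*} [MeasurableSpace Ω] {P : Measure Ω} [IsFiniteMeasure P]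
    {Y : Ω → ℝ} {p : ENNReal} (hY : MemLp Y p P) {u : ℝ → ℝ} (hu : Measurable u) {C : ℝ}
    (hC : ∀ y, |u y| ≤ C * (1 + |y|)) : MemLp (fun ω => u (Y ω)) p P := by
  have h0 : MemLp (fun _ : Ω => (1 : ℝ)) p P := memLp_const 1
  have h1 : MemLp (fun ω => 1 + |Y ω|) p P := h0.add hY.abs
  have h2 : MemLp (fun ω => C * (1 + |Y ω|)) p P := h1.const_mul C
  exact h2.mono' (hu.comp_aemeasurable hY.aestronglyMeasurable.aemeasurable).aestronglyMeasurable
    (ae_of_all _ fun ω => hC _)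

/-- Chatterjee's covariance identity. -/
lemma integral_mul_eq_resampleSum {f h : (Fin k → E) → ℝ} (hf : MemLp f 2 (Measure.pi μ))
    (hh : MemLp h 2 (Measure.pi μ)) (h0 : ∫ x, f x ∂Measure.pi μ = 0) :
    ∫ p, h p.1 * f p.1 ∂(Measure.pi μ).prod (Measure.pi μ) = resampleSum fun A j =>
      ∫ p, h p.1 * resampleDiff f j A p.1 p.2 ∂(Measure.pi μ).prod (Measure.pi μ) := by
  set ρ := (Measure.pi μ).prod (Measure.pi μ) with hρ
  have hh1 : MemLp (fun p : (Fin k → E) × (Fin k → E) => h p.1) 2 ρ := by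
    simpa using memLp_comp_resample μ hh ∅
  have key := sum_resample_telescope (k := k) fun A => ∫ p, h p.1 * f (resample p.1 p.2 A) ∂ρ
  -- At the far end of the telescope stands `f(X')`, which is independent of `X` and centred.
  have hu : ∫ p, h p.1 * f (resample p.1 p.2 Finset.univ) ∂ρ = 0 := by
    simp only [resample_univ]
    rw [hρ, integral_prod_mul, h0, mul_zero]
  rw [hu, sub_zero] at key
  simp only [resample_empty] at key
  rw [← key]
  refine Finset.sum_congr rfl fun A _ => ?_
  congr 1
  refine Finset.sum_congr rfl fun j _ => ?_
  have hi : ∀ B : Finset (Fin k), Integrable (fun p : (Fin k → E) × (Fin k → E) =>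
      h p.1 * f (resample p.1 p.2 B)) ρ := fun B =>
    hh1.integrable_mul (memLp_comp_resample μ hf B)
  rw [← integral_sub (hi A) (hi (insert j A))]
  simp only [resampleDiff, mul_sub]

/-- The normal approximation bound for a function of independent variables plus Gaussian noise,
in terms of `steinT` and `steinT'` tested against bounded functions. -/
theorem exists_abs_integral_gaussianReal_sub_le {f : (Fin k → E) → ℝ} (hfm : Measurable f)
    (hf : MemLp f 2 (Measure.pi μ)) (h0 : ∫ x, f x ∂Measure.pi μ = 0) (c : ℝ≥0) {K : ℝ≥0}
    (hK : K ≠ 0) (t : ℝ) :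
    ∃ γ ψ : ℝ → ℝ, Measurable γ ∧ Measurable ψ ∧ (∀ y, |γ y| ≤ 1 / K) ∧ (∀ y, |ψ y| ≤ 1 / K) ∧
      |∫ x, (gaussianReal 0 c).real (Set.Iic (t - f x)) ∂Measure.pi μ -
        (gaussianReal 0 K).real (Set.Iic t)| ≤
      |∫ p, γ (f p.1) * ((K : ℝ) - c - steinT f p.1 p.2) ∂(Measure.pi μ).prod (Measure.pi μ)| +
      |∫ p, ψ (f p.1) * steinT' f p.1 p.2 ∂(Measure.pi μ).prod (Measure.pi μ)| := by
  obtain ⟨g, g', Ψ, ψ, C, m, hg, hg', hΨ, hψ, hst, hg'b, hψb, hgl, hΨl, hin⟩ :=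
    exists_smoothed_stein_solution c hK t
  refine ⟨g', fun y => ψ y - m, hg', hψ.sub_const m, hg'b, hψb, ?_⟩
  set ρ := (Measure.pi μ).prod (Measure.pi μ) with hρ
  have hfst : MeasurePreserving Prod.fst ρ (Measure.pi μ) := measurePreserving_fst
  have hf1 : MemLp (fun p : (Fin k → E) × (Fin k → E) => f p.1) 2 ρ :=
    hf.comp_measurePreserving hfst
  have hδ := memLp_resampleDiff μ hf
  have hδm := measurable_resampleDiff (k := k) hfm
  have hδ0 : ∀ j (p : (Fin k → E) × (Fin k → E)),
      resampleDiff f j ∅ p.1 p.2 = f p.1 - f (resample p.1 p.2 {j}) := fun j p => by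
    simp [resampleDiff]
  have hfj : ∀ j, MemLp (fun p : (Fin k → E) × (Fin k → E) => f (resample p.1 p.2 {j})) 2 ρ :=
    fun j => memLp_comp_resample μ hf {j}
  have ibd : ∀ {u : ℝ → ℝ} {V : (Fin k → E) × (Fin k → E) → ℝ}, Measurable u →
      (∀ y, |u y| ≤ 1 / K) → Integrable V ρ → Integrable (fun p => u (f p.1) * V p) ρ :=
    fun {u V} hu hub hV => hV.bdd_mul
      (hu.comp (hfm.comp measurable_fst)).aestronglyMeasurable (ae_of_all _ fun p => hub _)
  have hDD : ∀ A j, Integrable (fun p : (Fin k → E) × (Fin k → E) =>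
      resampleDiff f j ∅ p.1 p.2 * resampleDiff f j A p.1 p.2) ρ :=
    fun A j => (hδ j ∅).integrable_mul (hδ j A)
  have hDD' : ∀ A j, Integrable (fun p : (Fin k → E) × (Fin k → E) =>
      resampleDiff f j ∅ p.1 p.2 * |resampleDiff f j A p.1 p.2|) ρ :=
    fun A j => (hδ j ∅).integrable_mul (hδ j A).abs
  have hg1 := memLp_comp_of_abs_le hf1 hg hgl
  have hT : Integrable (fun p => steinT f p.1 p.2) ρ :=
    (integrable_resampleSum hDD).const_mul _
  -- the inequality for one pair `(A, j)`
  have hpair : ∀ A : Finset (Fin k), ∀ j ∉ A,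
      |2 * ∫ p, g (f p.1) * resampleDiff f j A p.1 p.2 ∂ρ -
        ∫ p, g' (f p.1) * (resampleDiff f j ∅ p.1 p.2 * resampleDiff f j A p.1 p.2) ∂ρ| ≤
      ∫ p, (ψ (f p.1) - m) * (resampleDiff f j ∅ p.1 p.2 * |resampleDiff f j A p.1 p.2|) ∂ρ := by
    intro A j hj
    have hgj := memLp_comp_of_abs_le (hfj j) hg hgl
    have hΨ1 := memLp_comp_of_abs_le hf1 hΨ hΨl
    have hΨj := memLp_comp_of_abs_le (hfj j) hΨ hΨl
    have s1 := integral_resample_mul μ (hg.comp hfm) (hδm j A) (s := -1) (j := j)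
      fun p => by rw [resampleDiff_swapOn f hj, neg_one_mul]
    have s2 := fun {u : ℝ → ℝ} (hu : Measurable u) =>
      integral_resample_mul μ (hu.comp hfm) (hδm j A).abs (s := 1) (j := j)
        fun p => by rw [resampleDiff_swapOn f hj, abs_neg, one_mul]
    have s3 := s2 hΨ
    have s4 := s2 measurable_id
    simp only [Function.comp_apply, one_mul, id_eq, ← hρ] at s1 s3 s4
    have i1 : Integrable (fun p : (Fin k → E) × (Fin k → E) =>
      g (f p.1) * resampleDiff f j A p.1 p.2) ρ := hg1.integrable_mul (hδ j A)
    have i2 : Integrable (fun p : (Fin k → E) × (Fin k → E) =>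
      g (f (resample p.1 p.2 {j})) * resampleDiff f j A p.1 p.2) ρ := hgj.integrable_mul (hδ j A)
    have i3 := ibd hg' hg'b (hDD A j)
    have i4 : Integrable (fun p : (Fin k → E) × (Fin k → E) =>
      Ψ (f p.1) * |resampleDiff f j A p.1 p.2|) ρ := hΨ1.integrable_mul (hδ j A).abs
    have i5 : Integrable (fun p : (Fin k → E) × (Fin k → E) =>
      Ψ (f (resample p.1 p.2 {j})) * |resampleDiff f j A p.1 p.2|) ρ :=
      hΨj.integrable_mul (hδ j A).abs
    have i6 := ibd (hψ.sub_const m) hψb (hDD' A j)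
    have i7 : Integrable (fun p : (Fin k → E) × (Fin k → E) =>
      f p.1 * |resampleDiff f j A p.1 p.2|) ρ := hf1.integrable_mul (hδ j A).abs
    have i8 : Integrable (fun p : (Fin k → E) × (Fin k → E) =>
      f (resample p.1 p.2 {j}) * |resampleDiff f j A p.1 p.2|) ρ :=
      (hfj j).integrable_mul (hδ j A).abs
    have e1 : 2 * ∫ p, g (f p.1) * resampleDiff f j A p.1 p.2 ∂ρ -
        ∫ p, g' (f p.1) * (resampleDiff f j ∅ p.1 p.2 * resampleDiff f j A p.1 p.2) ∂ρ =
        ∫ p, (g (f p.1) * resampleDiff f j A p.1 p.2 -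
          g (f (resample p.1 p.2 {j})) * resampleDiff f j A p.1 p.2) -
          g' (f p.1) * (resampleDiff f j ∅ p.1 p.2 * resampleDiff f j A p.1 p.2) ∂ρ := by
      have i9 : Integrable (fun p : (Fin k → E) × (Fin k → E) =>
        g (f p.1) * resampleDiff f j A p.1 p.2 -
          g (f (resample p.1 p.2 {j})) * resampleDiff f j A p.1 p.2) ρ := i1.sub i2
      rw [integral_sub i9 i3, integral_sub i1 i2]
      linarith
    have j1 : Integrable (fun p : (Fin k → E) × (Fin k → E) =>
        Ψ (f (resample p.1 p.2 {j})) * |resampleDiff f j A p.1 p.2| -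
          Ψ (f p.1) * |resampleDiff f j A p.1 p.2|) ρ := i5.sub i4
    have j2 : Integrable (fun p : (Fin k → E) × (Fin k → E) =>
        m * (f p.1 * |resampleDiff f j A p.1 p.2| -
          f (resample p.1 p.2 {j}) * |resampleDiff f j A p.1 p.2|)) ρ := (i7.sub i8).const_mul m
    have j3 : Integrable (fun p : (Fin k → E) × (Fin k → E) =>
        (Ψ (f (resample p.1 p.2 {j})) * |resampleDiff f j A p.1 p.2| -
          Ψ (f p.1) * |resampleDiff f j A p.1 p.2|) +
        m * (f p.1 * |resampleDiff f j A p.1 p.2| -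
          f (resample p.1 p.2 {j}) * |resampleDiff f j A p.1 p.2|)) ρ := j1.add j2
    -- The added `Ψ` difference has zero integral by `s3`; by `s4` the same holds for the term in
    -- `m`, so replacing `ψ` by `ψ - m` is free.
    have e2 : ∫ p, (ψ (f p.1) - m) *
          (resampleDiff f j ∅ p.1 p.2 * |resampleDiff f j A p.1 p.2|) ∂ρ =
        ∫ p, ((Ψ (f (resample p.1 p.2 {j})) * |resampleDiff f j A p.1 p.2| -
          Ψ (f p.1) * |resampleDiff f j A p.1 p.2|) +
        m * (f p.1 * |resampleDiff f j A p.1 p.2| -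
          f (resample p.1 p.2 {j}) * |resampleDiff f j A p.1 p.2|)) +
        (ψ (f p.1) - m) * (resampleDiff f j ∅ p.1 p.2 * |resampleDiff f j A p.1 p.2|) ∂ρ := by
      rw [integral_add j3 i6, integral_add j1 j2, integral_sub i5 i4, integral_const_mul,
        integral_sub i7 i8, s3, s4]
      ring
    rw [e1, e2, ← Real.norm_eq_abs]
    refine norm_integral_le_of_norm_le (j3.add i6) (ae_of_all _ fun p => ?_)
    have h := mul_le_mul_of_nonneg_right (hin (f p.1) (f (resample p.1 p.2 {j})))
      (abs_nonneg (resampleDiff f j A p.1 p.2))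
    rw [← abs_mul] at h
    rw [Real.norm_eq_abs, hδ0]
    exact (le_of_eq (congrArg abs (by ring))).trans (h.trans (le_of_eq (by ring)))
  -- summation over `(A, j)`
  have hsum : |∫ p, g (f p.1) * f p.1 ∂ρ - ∫ p, g' (f p.1) * steinT f p.1 p.2 ∂ρ| ≤
      ∫ p, (ψ (f p.1) - m) * steinT' f p.1 p.2 ∂ρ := by
    have r1 : ∫ p, g (f p.1) * f p.1 ∂ρ = 1 / 2 * resampleSum fun A j =>
        2 * ∫ p, g (f p.1) * resampleDiff f j A p.1 p.2 ∂ρ := by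
      rw [integral_mul_eq_resampleSum μ hf (memLp_comp_of_abs_le hf hg hgl) h0,
        ← mul_resampleSum]
      ring
    have r2 : ∫ p, g' (f p.1) * steinT f p.1 p.2 ∂ρ = 1 / 2 * resampleSum fun A j =>
        ∫ p, g' (f p.1) * (resampleDiff f j ∅ p.1 p.2 * resampleDiff f j A p.1 p.2) ∂ρ := by
      rw [← integral_resampleSum fun A j => ibd hg' hg'b (hDD A j), ← integral_const_mul]
      refine integral_congr_ae (ae_of_all _ fun p => ?_)
      simp only [steinT_eq_resampleSum, ← mul_resampleSum]
      ring
    have r3 : ∫ p, (ψ (f p.1) - m) * steinT' f p.1 p.2 ∂ρ = 1 / 2 * resampleSum fun A j =>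
        ∫ p, (ψ (f p.1) - m) *
          (resampleDiff f j ∅ p.1 p.2 * |resampleDiff f j A p.1 p.2|) ∂ρ := by
      rw [← integral_resampleSum fun A j => ibd (hψ.sub_const m) hψb (hDD' A j),
        ← integral_const_mul]
      refine integral_congr_ae (ae_of_all _ fun p => ?_)
      simp only [steinT'_eq_resampleSum, ← mul_resampleSum]
      ring
    rw [r1, r2, r3, ← mul_sub, ← resampleSum_sub, abs_mul, abs_of_pos (by norm_num : (0:ℝ) < 1 / 2)]
    exact mul_le_mul_of_nonneg_left ((abs_resampleSum_le _).trans (resampleSum_mono hpair))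
      (by norm_num)
  have i1 : Integrable (fun p : (Fin k → E) × (Fin k → E) => g (f p.1) * f p.1) ρ :=
    hg1.integrable_mul hf1
  have i2 := ibd hg' hg'b hT
  have i3 : Integrable (fun p : (Fin k → E) × (Fin k → E) =>
      g' (f p.1) * ((K : ℝ) - c - steinT f p.1 p.2)) ρ :=
    ibd hg' hg'b ((integrable_const _).sub hT)
  have hmG : Measurable fun x => (gaussianReal 0 c).real (Set.Iic (t - f x)) := by
    have : Monotone fun y => (gaussianReal 0 c).real (Set.Iic y) := fun a b hab =>
      measureReal_mono (Set.Iic_subset_Iic.2 hab)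
    exact this.measurable.comp (hfm.const_sub t)
  -- Integrate the smoothed Stein equation at `y = f(X)`, then add and subtract `g'(f) T`.
  have hmain : ∫ x, (gaussianReal 0 c).real (Set.Iic (t - f x)) ∂Measure.pi μ -
      (gaussianReal 0 K).real (Set.Iic t) =
      ∫ p, g' (f p.1) * ((K : ℝ) - c - steinT f p.1 p.2) ∂ρ -
        (∫ p, g (f p.1) * f p.1 ∂ρ - ∫ p, g' (f p.1) * steinT f p.1 p.2 ∂ρ) := by
    have i4 : Integrable (fun x => (gaussianReal 0 c).real (Set.Iic (t - f x))) (Measure.pi μ) :=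
      Integrable.of_bound hmG.aestronglyMeasurable 1 (ae_of_all _ fun x => by
        rw [Real.norm_eq_abs, abs_of_nonneg measureReal_nonneg]; exact measureReal_le_one)
    have e3 : ∫ x, (gaussianReal 0 c).real (Set.Iic (t - f x)) ∂Measure.pi μ =
        ∫ p, (gaussianReal 0 c).real (Set.Iic (t - f p.1)) ∂ρ := by
      rw [← hfst.map_eq, integral_map hfst.measurable.aemeasurable hmG.aestronglyMeasurable]
    have e4 : ∫ p, (gaussianReal 0 c).real (Set.Iic (t - f p.1)) ∂ρ -
        (gaussianReal 0 K).real (Set.Iic t) =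
        ∫ p, ((gaussianReal 0 c).real (Set.Iic (t - f p.1)) -
          (gaussianReal 0 K).real (Set.Iic t)) ∂ρ := by
      have i6 : Integrable (fun p : (Fin k → E) × (Fin k → E) =>
        (gaussianReal 0 c).real (Set.Iic (t - f p.1))) ρ := i4.comp_fst _
      rw [integral_sub i6 (integrable_const _)]
      simp
    have i5 : Integrable (fun p : (Fin k → E) × (Fin k → E) =>
        g (f p.1) * f p.1 - g' (f p.1) * steinT f p.1 p.2) ρ := i1.sub i2
    rw [e3, e4, ← integral_sub i1 i2, ← integral_sub i3 i5]
    refine integral_congr_ae (ae_of_all _ fun p => ?_)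
    simp only
    rw [← hst]
    ring
  rw [hmain]
  refine (abs_sub _ _).trans (add_le_add le_rfl (hsum.trans (le_abs_self _)))

lemma memLp_resampleSum {Ω : Type*} [MeasurableSpace Ω] {P : Measure Ω} {p : ENNReal}
    {a : Finset (Fin k) → Fin k → Ω → ℝ} (h : ∀ A j, MemLp (a A j) p P) :
    MemLp (fun ω => resampleSum fun A j => a A j ω) p P :=
  memLp_finsetSum _ fun A _ => (memLp_finsetSum _ fun j _ => h A j).const_mul _

lemma memLp_two_mul {Ω : Type*} [MeasurableSpace Ω] {P : Measure Ω} {Y Z : Ω → ℝ}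
    (hY : MemLp Y 4 P) (hZ : MemLp Z 4 P) : MemLp (fun ω => Y ω * Z ω) 2 P := by
  have : ENNReal.HolderTriple 4 4 2 := ⟨by
    rw [← two_mul, show (4 : ENNReal) = 2 * 2 by norm_num,
      ENNReal.mul_inv (Or.inl two_ne_zero) (Or.inl ENNReal.ofNat_ne_top), ← mul_assoc,
      ENNReal.mul_inv_cancel two_ne_zero ENNReal.ofNat_ne_top, one_mul]⟩
  exact hZ.mul hY

/-- `steinT` is quadratic in the increments of `f`, so fourth moments of `f` are what square
integrability requires. -/
lemma memLp_steinT {f : (Fin k → E) → ℝ} (hf : MemLp f 4 (Measure.pi μ)) :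
    MemLp (fun p : (Fin k → E) × (Fin k → E) => steinT f p.1 p.2) 2
      ((Measure.pi μ).prod (Measure.pi μ)) :=
  (memLp_resampleSum fun A j => memLp_two_mul (memLp_resampleDiff μ hf j ∅)
    (memLp_resampleDiff μ hf j A)).const_mul _

lemma memLp_steinT' {f : (Fin k → E) → ℝ} (hf : MemLp f 4 (Measure.pi μ)) :
    MemLp (fun p : (Fin k → E) × (Fin k → E) => steinT' f p.1 p.2) 2
      ((Measure.pi μ).prod (Measure.pi μ)) :=
  (memLp_resampleSum fun A j => memLp_two_mul (memLp_resampleDiff μ hf j ∅)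
    (memLp_resampleDiff μ hf j A).abs).const_mul _

/-- Exchanging coordinate `j` changes the sign of `Δ_j f(X)` and keeps `|Δ_j f(X^A)|`. Hence the
variance of `E[T' | X]` is its second moment. -/
lemma integral_steinT'_eq_zero {f : (Fin k → E) → ℝ} (hfm : Measurable f)
    (hf : MemLp f 2 (Measure.pi μ)) :
    ∫ p, steinT' f p.1 p.2 ∂(Measure.pi μ).prod (Measure.pi μ) = 0 := by
  have hi : ∀ A j, Integrable (fun p : (Fin k → E) × (Fin k → E) =>
      resampleDiff f j ∅ p.1 p.2 * |resampleDiff f j A p.1 p.2|)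
      ((Measure.pi μ).prod (Measure.pi μ)) := fun A j =>
    (memLp_resampleDiff μ hf j ∅).integrable_mul (memLp_resampleDiff μ hf j A).abs
  simp only [steinT'_eq_resampleSum]
  rw [integral_const_mul, integral_resampleSum hi, resampleSum_congr (a' := fun _ _ => 0), resampleSum_const]
  · simp
  · intro A j hj
    have h := integral_comp_swapOn μ (A := {j}) ((measurable_resampleDiff hfm j ∅).mul
      (measurable_resampleDiff hfm j A).abs).aestronglyMeasurable
    simp only [Pi.mul_apply] at h ⊢
    simp only [resampleDiff_swapOn f hj, resampleDiff_swapOn f (Finset.notMem_empty j), abs_neg,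
      neg_mul, integral_neg] at h
    linarith

end ResamplingBound

/-! ### Conditional expectations and convolution with Gaussian noise. -/

section ConditionalBounds

variable {Ω : Type*} {m0 : MeasurableSpace Ω} {P : Measure Ω}

lemma memLp_of_integrable_pow {Y : Ω → ℝ} (hY : AEStronglyMeasurable Y P) {n : ℕ} (hn : n ≠ 0)
    (h : Integrable (fun ω => |Y ω| ^ n) P) : MemLp Y n P := by
  have hn' : (n : ENNReal) ≠ 0 := by exact_mod_cast hn
  refine (integrable_norm_rpow_iff hY hn' (ENNReal.natCast_ne_top n)).1 ?_
  simpa using h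

lemma kolDist_le {μ ν : Measure ℝ} {B : ℝ}
    (h : ∀ t, |μ.real (Set.Iic t) - ν.real (Set.Iic t)| ≤ B) : kolDist μ ν ≤ B :=
  ciSup_le h

variable [IsProbabilityMeasure P]

lemma integral_abs_le_sqrt {Y : Ω → ℝ} (hY : MemLp Y 2 P) :
    ∫ ω, |Y ω| ∂P ≤ √(∫ ω, Y ω ^ 2 ∂P) := by
  refine Real.le_sqrt_of_sq_le ?_
  have h := variance_nonneg |Y| P
  rw [variance_eq_sub hY.abs] at h
  simp only [Pi.pow_apply, Pi.abs_apply, sq_abs] at h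
  linarith

/-- Testing against a bounded `m`-measurable function only sees the conditional expectation. -/
lemma abs_integral_mul_le_sqrt_condExp {m : MeasurableSpace Ω} (hm : m ≤ m0) {γ Z : Ω → ℝ}
    (hγ : StronglyMeasurable[m] γ) {B : ℝ} (hB : ∀ ω, |γ ω| ≤ B) (hZ : MemLp Z 2 P) :
    |∫ ω, γ ω * Z ω ∂P| ≤ B * √(∫ ω, (P[Z | m]) ω ^ 2 ∂P) := by
  have hZ1 : Integrable Z P := hZ.integrable one_le_two
  have hi : Integrable (γ * Z) P :=
    hZ1.bdd_mul (hγ.mono hm).aestronglyMeasurable (ae_of_all _ hB)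
  have hB0 : 0 ≤ B := by
    obtain ⟨ω⟩ := nonempty_of_isProbabilityMeasure P
    exact (abs_nonneg _).trans (hB ω)
  have hc := hZ.condExp (m := m) one_le_two
  calc |∫ ω, γ ω * Z ω ∂P| = |∫ ω, (P[γ * Z | m]) ω ∂P| := by rw [integral_condExp hm]; rfl
    _ = |∫ ω, γ ω * (P[Z | m]) ω ∂P| := by
        rw [integral_congr_ae (condExp_mul_of_stronglyMeasurable_left hγ hi hZ1)]; rfl
    _ ≤ ∫ ω, B * |(P[Z | m]) ω| ∂P := by
        rw [← Real.norm_eq_abs]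
        refine norm_integral_le_of_norm_le ((hc.integrable one_le_two).abs.const_mul B)
          (ae_of_all _ fun ω => ?_)
        rw [Real.norm_eq_abs, abs_mul]
        exact mul_le_mul_of_nonneg_right (hB ω) (abs_nonneg _)
    _ = B * ∫ ω, |(P[Z | m]) ω| ∂P := integral_const_mul _ _
    _ ≤ _ := mul_le_mul_of_nonneg_left (integral_abs_le_sqrt hc) hB0

/-- The distribution function of a random variable perturbed by independent Gaussian noise. -/
lemma map_add_gaussianReal_real_Iic {b Y : Ω → ℝ} {c : ℝ≥0} (hb : HasLaw b (gaussianReal 0 c) P)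
    (hY : AEMeasurable Y P) (hind : IndepFun b Y P) (t : ℝ) :
    (P.map fun ω => b ω + Y ω).real (Set.Iic t) =
      ∫ ω, (gaussianReal 0 c).real (Set.Iic (t - Y ω)) ∂P := by
  have := Measure.isProbabilityMeasure_map hY
  have hmono : Monotone fun y => gaussianReal 0 c (Set.Iic y) := fun a b hab =>
    measure_mono (Set.Iic_subset_Iic.2 hab)
  have hm : Measurable fun y : ℝ => gaussianReal 0 c (Set.Iic (t - y)) :=
    hmono.measurable.comp (measurable_id.const_sub t)
  have hs : MeasurableSet {p : ℝ × ℝ | p.1 + p.2 ≤ t} :=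
    measurableSet_le (by fun_prop) measurable_const
  have h1 : (P.map fun ω => b ω + Y ω) (Set.Iic t) =
      ∫⁻ y, gaussianReal 0 c (Set.Iic (t - y)) ∂P.map Y := by
    have e : (fun ω => b ω + Y ω) = (fun p : ℝ × ℝ => p.1 + p.2) ∘ fun ω => (b ω, Y ω) := rfl
    rw [e, ← AEMeasurable.map_map_of_aemeasurable (by fun_prop) (hb.aemeasurable.prodMk hY),
      hind.map_prod_eq_prod_map_map hb.aemeasurable hY, hb.map_eq,
      Measure.map_apply (by fun_prop) measurableSet_Iic]
    refine (Measure.prod_apply_symm (s := {p : ℝ × ℝ | p.1 + p.2 ≤ t}) hs).trans ?_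
    refine lintegral_congr fun y => ?_
    congr 1
    ext x
    simp [le_sub_iff_add_le]
  rw [measureReal_def, h1, lintegral_map' hm.aemeasurable hY]
  exact (integral_toReal (hm.comp_aemeasurable hY) (ae_of_all _ fun ω => measure_lt_top _ _)).symm

end ConditionalBounds

/-! ### The bound for a function of independent variables. -/

section IndependentFunctional

variable {Ω E : Type*} [MeasurableSpace Ω] {P : Measure Ω} [IsProbabilityMeasure P]
  [MeasurableSpace E] {k : ℕ}

/-- The test functions `γ, ψ` depend on `X` only through `f(X)` and are bounded by `1 / K`. So `T`
and `T'` may be replaced by their conditional expectations given `X`, and Cauchy-Schwarz applies. -/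
theorem kolDist_add_le {X X' : Ω → Fin k → E} {b : Ω → ℝ} {f : (Fin k → E) → ℝ} {c K : ℝ≥0}
    (hX : Measurable X) (hX' : Measurable X') (hf : Measurable f)
    (hind : iIndepFun (fun i ω => X ω i) P) (hid : IdentDistrib X' X P P) (hXX' : IndepFun X X' P)
    (hb : HasLaw b (gaussianReal 0 c) P) (hbX : IndepFun b X P) (hK : K ≠ 0)
    (hf4 : MemLp (fun ω => f (X ω)) 4 P) (h0 : ∫ ω, f (X ω) ∂P = 0) :
    kolDist (P.map fun ω => b ω + f (X ω)) (gaussianReal 0 K) ≤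
      1 / (K : ℝ) * √(∫ ω, (P[fun ω' => (K : ℝ) - (c : ℝ) - steinT f (X ω') (X' ω') |
        MeasurableSpace.comap X inferInstance] ω) ^ 2 ∂P) +
      1 / (K : ℝ) * √(variance (P[fun ω' => steinT' f (X ω') (X' ω') |
        MeasurableSpace.comap X inferInstance]) P) := by
  set μ : Fin k → Measure E := fun i => P.map fun ω => X ω i with hμ
  have hXi : ∀ i, Measurable fun ω => X ω i := fun i => (measurable_pi_apply i).comp hX
  have : ∀ i, IsProbabilityMeasure (μ i) := fun i =>
    Measure.isProbabilityMeasure_map (hXi i).aemeasurable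
  have hmap : P.map X = Measure.pi μ := hind.map_fun_eq_pi_map fun i => (hXi i).aemeasurable
  have hpX : MeasurePreserving X P (Measure.pi μ) := ⟨hX, hmap⟩
  have hpp : MeasurePreserving (fun ω => (X ω, X' ω)) P
      ((Measure.pi μ).prod (Measure.pi μ)) := by
    refine ⟨hX.prodMk hX', ?_⟩
    rw [hXX'.map_prod_eq_prod_map_map hX.aemeasurable hX'.aemeasurable, hid.map_eq, hmap]
  have hfμ : MemLp f 4 (Measure.pi μ) := by
    rw [← hmap]
    exact (memLp_map_measure_iff hf.aestronglyMeasurable hX.aemeasurable).2 hf4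
  have hfμ2 : MemLp f 2 (Measure.pi μ) := hfμ.mono_exponent (by norm_num)
  have h0μ : ∫ x, f x ∂Measure.pi μ = 0 := by
    rw [← hmap, integral_map hX.aemeasurable hf.aestronglyMeasurable, h0]
  have hT := MemLp.comp_measurePreserving (memLp_steinT μ hfμ) hpp
  replace hT : MemLp (fun ω => steinT f (X ω) (X' ω)) 2 P := hT
  have hT' := MemLp.comp_measurePreserving (memLp_steinT' μ hfμ) hpp
  replace hT' : MemLp (fun ω => steinT' f (X ω) (X' ω)) 2 P := hT'
  have hle : MeasurableSpace.comap X inferInstance ≤ (inferInstance : MeasurableSpace Ω) :=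
    hX.comap_le
  have htr : ∀ {G : (Fin k → E) × (Fin k → E) → ℝ},
      AEStronglyMeasurable G ((Measure.pi μ).prod (Measure.pi μ)) →
      ∫ p, G p ∂(Measure.pi μ).prod (Measure.pi μ) = ∫ ω, G (X ω, X' ω) ∂P := by
    intro G hG
    rw [← hpp.map_eq] at hG ⊢
    exact integral_map hpp.measurable.aemeasurable hG
  have hγf : ∀ {γ : ℝ → ℝ}, Measurable γ →
      StronglyMeasurable[MeasurableSpace.comap X inferInstance] fun ω => γ (f (X ω)) := fun hγ =>
    ((hγ.comp hf).comp (comap_measurable X)).stronglyMeasurable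
  have hT'0 : ∫ ω, steinT' f (X ω) (X' ω) ∂P = 0 := by
    rw [← integral_steinT'_eq_zero μ hf hfμ2, htr (memLp_steinT' μ hfμ).aestronglyMeasurable]
  refine kolDist_le fun t => ?_
  obtain ⟨γ, ψ, hγ, hψ, hγb, hψb, hmain⟩ :=
    exists_abs_integral_gaussianReal_sub_le μ hf hfμ2 h0μ c hK t
  have hm : Measurable fun y : ℝ => (gaussianReal 0 c).real (Set.Iic (t - y)) := by
    have : Monotone fun y => (gaussianReal 0 c).real (Set.Iic y) := fun a b hab =>
      measureReal_mono (Set.Iic_subset_Iic.2 hab)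
    exact this.measurable.comp (measurable_id.const_sub t)
  have hfst : ∀ {γ : ℝ → ℝ}, Measurable γ → AEStronglyMeasurable
      (fun p : (Fin k → E) × (Fin k → E) => γ (f p.1)) ((Measure.pi μ).prod (Measure.pi μ)) :=
    fun hγ => ((hγ.comp hf).comp measurable_fst).aestronglyMeasurable
  rw [map_add_gaussianReal_real_Iic (Y := fun ω => f (X ω)) hb (hf.comp hX).aemeasurable
    (hbX.comp measurable_id hf) t]
  have e1 : ∫ x, (gaussianReal 0 c).real (Set.Iic (t - f x)) ∂Measure.pi μ =
      ∫ ω, (gaussianReal 0 c).real (Set.Iic (t - f (X ω))) ∂P := by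
    rw [← hmap]
    exact integral_map hX.aemeasurable (hm.comp hf).aestronglyMeasurable
  have e2 := htr ((hfst hγ).mul
    ((aestronglyMeasurable_const (b := (K : ℝ) - c)).sub (memLp_steinT μ hfμ).aestronglyMeasurable))
  have e3 := htr ((hfst hψ).mul (memLp_steinT' μ hfμ).aestronglyMeasurable)
  simp only [Pi.mul_apply, Pi.sub_apply] at e2 e3
  rw [e1, e2, e3] at hmain
  refine hmain.trans (add_le_add ?_ ?_)
  · exact abs_integral_mul_le_sqrt_condExp hle (hγf hγ) (fun ω => hγb _) ((memLp_const _).sub hT)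
  · rw [variance_eq_sub (hT'.condExp one_le_two), integral_condExp hle, hT'0]
    simp only [ne_eq, OfNat.ofNat_ne_zero, not_false_eq_true, zero_pow, sub_zero]
    exact abs_integral_mul_le_sqrt_condExp hle (hγf hψ) (fun ω => hψb _) hT'

end IndependentFunctional

/-! ### Linear forms in independent standardized weights. -/

section LinearForm

variable {n : ℕ}

/-- The increment of a linear form does not depend on `A`, so the weighted sums in `steinT` and
`steinT'` collapse to single sums over `j`. -/
lemma resampleDiff_linear (a : Fin n → ℝ) {j : Fin n} {A : Finset (Fin n)} (hj : j ∉ A)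
    (x x' : Fin n → ℝ) :
    resampleDiff (fun y => ∑ i, a i * y i) j A x x' = a j * (x j - x' j) := by
  rw [resampleDiff, ← Finset.sum_sub_distrib, Finset.sum_eq_single j]
  · simp only [resample, hj, Finset.mem_insert_self, if_true, if_false]; ring
  · intro i _ hi
    simp [resample, hi]
  · simp

lemma steinT_linear (a x x' : Fin n → ℝ) :
    steinT (fun y => ∑ i, a i * y i) x x' = ∑ j, a j ^ 2 * (1 / 2 * (x j - x' j) ^ 2) := by
  rw [steinT_eq_resampleSum, resampleSum_congr (a' := fun _ j => a j ^ 2 * (x j - x' j) ^ 2),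
    resampleSum_const, Finset.mul_sum]
  · exact Finset.sum_congr rfl fun j _ => by ring
  · intro A j hj
    rw [resampleDiff_linear a hj, resampleDiff_linear a (Finset.notMem_empty j)]
    ring

lemma steinT'_linear (a x x' : Fin n → ℝ) :
    steinT' (fun y => ∑ i, a i * y i) x x' =
      ∑ j, (a j * |a j|) * (1 / 2 * ((x j - x' j) * |x j - x' j|)) := by
  rw [steinT'_eq_resampleSum, resampleSum_congr
    (a' := fun _ j => (a j * |a j|) * ((x j - x' j) * |x j - x' j|)),
    resampleSum_const, Finset.mul_sum]
  · exact Finset.sum_congr rfl fun j _ => by ring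
  · intro A j hj
    rw [resampleDiff_linear a hj, resampleDiff_linear a (Finset.notMem_empty j), abs_mul]
    ring

variable {w : Measure ℝ} [IsProbabilityMeasure w]

/-- The second moment of a sum of independent centred functions of the pairs `(x_j, x'_j)`. -/
lemma sqrt_integral_sq_sum_pairs {q : ℝ × ℝ → ℝ} (hq : MemLp q 2 (w.prod w))
    (h0 : ∫ p, q p ∂w.prod w = 0) (c : Fin n → ℝ) :
    MemLp (fun p : (Fin n → ℝ) × (Fin n → ℝ) => ∑ j, c j * q (p.1 j, p.2 j)) 2
      ((Measure.pi fun _ => w).prod (Measure.pi fun _ => w)) ∧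
    ∫ p : (Fin n → ℝ) × (Fin n → ℝ), |∑ j, c j * q (p.1 j, p.2 j)|
      ∂(Measure.pi fun _ => w).prod (Measure.pi fun _ => w) ≤
      √(∫ p, q p ^ 2 ∂w.prod w) * √(∑ j, c j ^ 2) := by
  set ρ := (Measure.pi fun _ : Fin n => w).prod (Measure.pi fun _ : Fin n => w) with hρ
  have he := measurePreserving_arrowProdEquivProdArrow ℝ ℝ (Fin n) (fun _ => w) (fun _ => w)
  have hs := he.symm
  set e := (MeasurableEquiv.arrowProdEquivProdArrow ℝ ℝ (Fin n)).symm with hedef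
  set Y : (Fin n → ℝ × ℝ) → ℝ := fun y => ∑ j, c j * q (y j) with hY
  have hcomp : (fun p : (Fin n → ℝ) × (Fin n → ℝ) => ∑ j, c j * q (p.1 j, p.2 j)) = Y ∘ e := rfl
  have hqj : ∀ j, MemLp (fun p => c j * q p) 2 (w.prod w) := fun j => hq.const_mul (c j)
  have hqpi : ∀ j, MemLp (fun y : Fin n → ℝ × ℝ => c j * q (y j)) 2
      (Measure.pi fun _ => w.prod w) := fun j =>
    (hqj j).comp_measurePreserving (measurePreserving_eval (fun _ => w.prod w) j)
  have hYm : MemLp Y 2 (Measure.pi fun _ => w.prod w) := memLp_finsetSum _ fun j _ => hqpi j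
  have hYe : MemLp (Y ∘ e) 2 ρ := hYm.comp_measurePreserving hs
  rw [hcomp]
  refine ⟨hYe, ?_⟩
  -- In the vector-of-pairs picture the summands are independent and centred, so the second moment
  -- is the sum of the variances.
  have hvar := variance_sum_pi (μ := fun _ : Fin n => w.prod w) (X := fun j p => c j * q p) hqj
  have hv1 : ∀ j, Var[fun p => c j * q p; w.prod w] = c j ^ 2 * ∫ p, q p ^ 2 ∂w.prod w := by
    intro j
    rw [variance_const_mul, variance_eq_sub hq, h0]
    simp
  have hY0 : ∫ y, Y y ∂(Measure.pi fun _ : Fin n => w.prod w) = 0 := by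
    rw [hY, integral_finsetSum _ fun j _ => (hqpi j).integrable one_le_two]
    refine Finset.sum_eq_zero fun j _ => ?_
    rw [integral_const_mul]
    have := integral_comp_eval (μ := fun _ : Fin n => w.prod w) (i := j) (f := q)
      hq.aestronglyMeasurable
    rw [this, h0, mul_zero]
  have hv2 : ∫ y, Y y ^ 2 ∂(Measure.pi fun _ : Fin n => w.prod w) =
      (∫ p, q p ^ 2 ∂w.prod w) * ∑ j, c j ^ 2 := by
    have h1 := variance_eq_sub hYm
    rw [hY0] at h1
    have h2 : (∑ i, fun ω : Fin n → ℝ × ℝ => c i * q (ω i)) = Y := by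
      funext y; simp [hY, Finset.sum_apply]
    rw [h2, h1] at hvar
    simp only [Pi.pow_apply, ne_eq, OfNat.ofNat_ne_zero, not_false_eq_true, zero_pow, sub_zero,
      hv1] at hvar
    rw [hvar, ← Finset.sum_mul, mul_comm]
  calc ∫ p, |(Y ∘ e) p| ∂ρ = ∫ y, |Y y| ∂(Measure.pi fun _ : Fin n => w.prod w) :=
        hs.integral_comp e.measurableEmbedding fun y => |Y y|
    _ ≤ √(∫ y, Y y ^ 2 ∂(Measure.pi fun _ : Fin n => w.prod w)) := integral_abs_le_sqrt hYm
    _ = _ := by rw [hv2, Real.sqrt_mul (integral_nonneg fun p => sq_nonneg _)]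

lemma one_le_integral_pow_four (h4 : MemLp id 4 w) (h2 : ∫ x, x ^ 2 ∂w = 1) :
    1 ≤ ∫ x, x ^ 4 ∂w := by
  have i4 : Integrable (fun x : ℝ => x ^ 4) w := by
    simpa [Even.pow_abs (by decide : Even 4)] using h4.integrable_norm_pow'
  have i2 : Integrable (fun x : ℝ => x ^ 2) w := (h4.mono_exponent (by norm_num)).integrable_sq
  have h : ∫ x, (2 * x ^ 2 - 1) ∂w ≤ ∫ x, x ^ 4 ∂w :=
    integral_mono ((i2.const_mul 2).sub (integrable_const 1)) i4 fun x => by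
      simp only; nlinarith [sq_nonneg (x ^ 2 - 1)]
  rw [integral_sub (i2.const_mul 2) (integrable_const 1), integral_const_mul, h2] at h
  simp only [integral_const, probReal_univ, smul_eq_mul] at h
  linarith

lemma memLp_fst_sub_snd (h4 : MemLp id 4 w) :
    MemLp (fun p : ℝ × ℝ => p.1 - p.2) 4 (w.prod w) :=
  (h4.comp_fst w).sub (h4.comp_snd w)

lemma integral_fst_sub_snd_sq (h4 : MemLp id 4 w) (h1 : ∫ x, x ∂w = 0) (h2 : ∫ x, x ^ 2 ∂w = 1) :
    ∫ p : ℝ × ℝ, (p.1 - p.2) ^ 2 ∂w.prod w = 2 := by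
  have i1 : Integrable (fun x : ℝ => x) w := h4.integrable (by norm_num)
  have i2 : Integrable (fun x : ℝ => x ^ 2) w := (h4.mono_exponent (by norm_num)).integrable_sq
  have j1 : Integrable (fun p : ℝ × ℝ => p.1 ^ 2) (w.prod w) := i2.comp_fst w
  have j2 : Integrable (fun p : ℝ × ℝ => p.2 ^ 2) (w.prod w) := i2.comp_snd w
  have j3 : Integrable (fun p : ℝ × ℝ => 2 * (p.1 * p.2)) (w.prod w) :=
    (i1.mul_prod i1).const_mul 2
  have e : ∀ p : ℝ × ℝ, (p.1 - p.2) ^ 2 = p.1 ^ 2 + p.2 ^ 2 - 2 * (p.1 * p.2) := fun p => by ring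
  have j4 : Integrable (fun p : ℝ × ℝ => p.1 ^ 2 + p.2 ^ 2) (w.prod w) := j1.add j2
  simp_rw [e]
  rw [integral_sub j4 j3, integral_add j1 j2, integral_const_mul,
    integral_prod_mul (fun x : ℝ => x) (fun x : ℝ => x), integral_fun_fst (fun x => x ^ 2),
    integral_fun_snd (fun x => x ^ 2), h1, h2]
  norm_num

lemma integral_fst_sub_snd_pow_four (h4 : MemLp id 4 w) (h1 : ∫ x, x ∂w = 0)
    (h2 : ∫ x, x ^ 2 ∂w = 1) :
    ∫ p : ℝ × ℝ, (p.1 - p.2) ^ 4 ∂w.prod w = 2 * ∫ x, x ^ 4 ∂w + 6 := by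
  have i1 : Integrable (fun x : ℝ => x) w := h4.integrable (by norm_num)
  have i2 : Integrable (fun x : ℝ => x ^ 2) w := (h4.mono_exponent (by norm_num)).integrable_sq
  have i3 : Integrable (fun x : ℝ => x ^ 3) w := by
    have h3 : MemLp id ((3 : ℕ) : ENNReal) w := h4.mono_exponent (by norm_num)
    refine (integrable_norm_iff (by fun_prop)).1 ?_
    simpa using h3.integrable_norm_pow'
  have i4 : Integrable (fun x : ℝ => x ^ 4) w := by
    simpa [Even.pow_abs (by decide : Even 4)] using h4.integrable_norm_pow'
  have j1 : Integrable (fun p : ℝ × ℝ => p.1 ^ 4) (w.prod w) := i4.comp_fst w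
  have j2 : Integrable (fun p : ℝ × ℝ => p.2 ^ 4) (w.prod w) := i4.comp_snd w
  have j3 : Integrable (fun p : ℝ × ℝ => 4 * (p.1 ^ 3 * p.2)) (w.prod w) :=
    (i3.mul_prod i1).const_mul 4
  have j4 : Integrable (fun p : ℝ × ℝ => 4 * (p.1 * p.2 ^ 3)) (w.prod w) :=
    (i1.mul_prod i3).const_mul 4
  have j5 : Integrable (fun p : ℝ × ℝ => 6 * (p.1 ^ 2 * p.2 ^ 2)) (w.prod w) :=
    (i2.mul_prod i2).const_mul 6
  have e : ∀ p : ℝ × ℝ, (p.1 - p.2) ^ 4 = p.1 ^ 4 + p.2 ^ 4 + 6 * (p.1 ^ 2 * p.2 ^ 2) -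
      4 * (p.1 ^ 3 * p.2) - 4 * (p.1 * p.2 ^ 3) := fun p => by ring
  have k1 : Integrable (fun p : ℝ × ℝ => p.1 ^ 4 + p.2 ^ 4) (w.prod w) := j1.add j2
  have k2 : Integrable (fun p : ℝ × ℝ => p.1 ^ 4 + p.2 ^ 4 + 6 * (p.1 ^ 2 * p.2 ^ 2))
    (w.prod w) := k1.add j5
  have k3 : Integrable (fun p : ℝ × ℝ => p.1 ^ 4 + p.2 ^ 4 + 6 * (p.1 ^ 2 * p.2 ^ 2) -
    4 * (p.1 ^ 3 * p.2)) (w.prod w) := k2.sub j3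
  simp_rw [e]
  rw [integral_sub k3 j4, integral_sub k2 j3, integral_add k1 j5, integral_add j1 j2,
    integral_const_mul, integral_const_mul, integral_const_mul,
    integral_prod_mul (fun x : ℝ => x ^ 3) (fun x : ℝ => x),
    integral_prod_mul (fun x : ℝ => x) (fun x : ℝ => x ^ 3),
    integral_prod_mul (fun x : ℝ => x ^ 2) (fun x : ℝ => x ^ 2), integral_fun_fst (fun x => x ^ 4),
    integral_fun_snd (fun x => x ^ 4), h1, h2]
  simp only [probReal_univ, one_smul]
  ring

/-- Normal approximation of a linear form in independent standardized variables plus Gaussian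
noise. -/
theorem abs_integral_linear_gaussianReal_sub_le (h4 : MemLp id 4 w) (h1 : ∫ x, x ∂w = 0)
    (h2 : ∫ x, x ^ 2 ∂w = 1) (a : Fin n → ℝ) (c : ℝ≥0) {K : ℝ≥0} (hK : K ≠ 0) (t : ℝ) :
    |∫ x, (gaussianReal 0 c).real (Set.Iic (t - ∑ j, a j * x j)) ∂(Measure.pi fun _ => w) -
      (gaussianReal 0 K).real (Set.Iic t)| ≤
    1 / (K : ℝ) * (|∑ j, a j ^ 2 - K + c| +
      5 / 2 * √(∫ x, x ^ 4 ∂w) * √(∑ j, a j ^ 4)) := by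
  set f : (Fin n → ℝ) → ℝ := fun y => ∑ j, a j * y j with hf
  set ρ := (Measure.pi fun _ : Fin n => w).prod (Measure.pi fun _ : Fin n => w) with hρ
  have hfm : Measurable f := by fun_prop
  have hj : ∀ j, MemLp (fun x : Fin n → ℝ => a j * x j) 4 (Measure.pi fun _ => w) := fun j =>
    (h4.comp_measurePreserving (measurePreserving_eval (fun _ => w) j)).const_mul (a j)
  have hfL4 : MemLp f 4 (Measure.pi fun _ => w) := memLp_finsetSum _ fun j _ => hj j
  have hfL : MemLp f 2 (Measure.pi fun _ => w) := hfL4.mono_exponent (by norm_num)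
  have hf0 : ∫ x, f x ∂(Measure.pi fun _ : Fin n => w) = 0 := by
    rw [hf, integral_finsetSum _ fun j _ => (hj j).integrable (by norm_num)]
    refine Finset.sum_eq_zero fun j _ => ?_
    have := integral_comp_eval (μ := fun _ : Fin n => w) (i := j) (f := fun x => x)
      measurable_id.aestronglyMeasurable
    rw [integral_const_mul, this, h1, mul_zero]
  obtain ⟨γ, ψ, hγ, hψ, hγb, hψb, hmain⟩ :=
    exists_abs_integral_gaussianReal_sub_le (fun _ : Fin n => w) hfm hfL hf0 c hK t
  set m4 := ∫ x, x ^ 4 ∂w with hm4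
  have hm41 : 1 ≤ m4 := one_le_integral_pow_four h4 h2
  have hD := memLp_fst_sub_snd h4
  -- the two functions of a pair
  set q1 : ℝ × ℝ → ℝ := fun p => 1 / 2 * (p.1 - p.2) ^ 2 - 1 with hq1
  set q2 : ℝ × ℝ → ℝ := fun p => 1 / 2 * ((p.1 - p.2) * |p.1 - p.2|) with hq2
  have hDD : MemLp (fun p : ℝ × ℝ => (p.1 - p.2) ^ 2) 2 (w.prod w) := by
    simpa [sq] using memLp_two_mul hD hD
  have iDD : Integrable (fun p : ℝ × ℝ => (p.1 - p.2) ^ 2) (w.prod w) := hDD.integrable one_le_two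
  have iD4 : Integrable (fun p : ℝ × ℝ => (p.1 - p.2) ^ 4) (w.prod w) := by
    have := hDD.integrable_sq
    simpa only [← pow_mul] using this
  have hq1L : MemLp q1 2 (w.prod w) := (hDD.const_mul _).sub (memLp_const 1)
  have hq2L : MemLp q2 2 (w.prod w) := (memLp_two_mul hD hD.abs).const_mul _
  have hq10 : ∫ p, q1 p ∂w.prod w = 0 := by
    rw [hq1, integral_sub (iDD.const_mul _) (integrable_const 1), integral_const_mul,
      integral_fst_sub_snd_sq h4 h1 h2]
    simp
  have hq20 : ∫ p, q2 p ∂w.prod w = 0 := by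
    have h := integral_prod_swap (μ := w) (ν := w) q2
    have e : ∀ p : ℝ × ℝ, q2 p.swap = -q2 p := fun p => by
      simp only [hq2, Prod.fst_swap, Prod.snd_swap, abs_sub_comm p.2 p.1]; ring
    simp only [e, integral_neg] at h
    linarith
  -- The integral is `m4 / 2 + 1 / 2`, and `1 ≤ m4`.
  have hq1s : ∫ p, q1 p ^ 2 ∂w.prod w ≤ m4 := by
    have e : ∀ p : ℝ × ℝ, q1 p ^ 2 = 1 / 4 * (p.1 - p.2) ^ 4 - (p.1 - p.2) ^ 2 + 1 := fun p => by
      simp only [hq1]; ring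
    have k1 : Integrable (fun p : ℝ × ℝ => 1 / 4 * (p.1 - p.2) ^ 4 - (p.1 - p.2) ^ 2)
      (w.prod w) := (iD4.const_mul _).sub iDD
    simp_rw [e]
    rw [integral_add k1 (integrable_const 1), integral_sub (iD4.const_mul _) iDD,
      integral_const_mul, integral_fst_sub_snd_sq h4 h1 h2,
      integral_fst_sub_snd_pow_four h4 h1 h2]
    simp only [integral_const, probReal_univ, smul_eq_mul]
    linarith
  -- The integral is `m4 / 2 + 3 / 2`, again with `1 ≤ m4`.
  have hq2s : ∫ p, q2 p ^ 2 ∂w.prod w ≤ 2 * m4 := by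
    have e : ∀ p : ℝ × ℝ, q2 p ^ 2 = 1 / 4 * (p.1 - p.2) ^ 4 := fun p => by
      simp only [hq2, mul_pow, sq_abs]; ring
    simp_rw [e]
    rw [integral_const_mul, integral_fst_sub_snd_pow_four h4 h1 h2]
    linarith
  obtain ⟨hS1, hB1⟩ := sqrt_integral_sq_sum_pairs hq1L hq10 fun j => a j ^ 2
  obtain ⟨hS2, hB2⟩ := sqrt_integral_sq_sum_pairs hq2L hq20 fun j => a j * |a j|
  have hc1 : ∀ j, (a j ^ 2) ^ 2 = a j ^ 4 := fun j => by ring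
  have hc2 : ∀ j, (a j * |a j|) ^ 2 = a j ^ 4 := fun j => by rw [mul_pow, sq_abs]; ring
  simp only [hc1] at hB1
  simp only [hc2] at hB2
  have hT1 : |∫ p, γ (f p.1) * ((K : ℝ) - c - steinT f p.1 p.2) ∂ρ| ≤
      1 / (K : ℝ) * (|∑ j, a j ^ 2 - K + c| + √m4 * √(∑ j, a j ^ 4)) := by
    have hle : ∀ p : (Fin n → ℝ) × (Fin n → ℝ),
        ‖γ (f p.1) * ((K : ℝ) - c - steinT f p.1 p.2)‖ ≤
        1 / (K : ℝ) * (|∑ j, a j ^ 2 - K + c| + |∑ j, a j ^ 2 * q1 (p.1 j, p.2 j)|) := by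
      intro p
      -- Split `T` into its mean `∑ a_j²`, which gives the deterministic error, and a centred
      -- fluctuation.
      have e : (K : ℝ) - c - steinT f p.1 p.2 =
          -(∑ j, a j ^ 2 - K + c) - ∑ j, a j ^ 2 * q1 (p.1 j, p.2 j) := by
        rw [hf, steinT_linear]
        simp only [hq1, mul_sub, mul_one, Finset.sum_sub_distrib]
        ring
      rw [Real.norm_eq_abs, abs_mul, e]
      refine mul_le_mul (hγb _) ?_ (abs_nonneg _) (by positivity)
      refine (abs_sub _ _).trans ?_
      rw [abs_neg]
    have hi : Integrable (fun p : (Fin n → ℝ) × (Fin n → ℝ) =>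
        |∑ j, a j ^ 2 * q1 (p.1 j, p.2 j)|) ρ := (hS1.integrable one_le_two).abs
    have hi' : Integrable (fun p : (Fin n → ℝ) × (Fin n → ℝ) =>
        |∑ j, a j ^ 2 - K + c| + |∑ j, a j ^ 2 * q1 (p.1 j, p.2 j)|) ρ :=
      (integrable_const _).add hi
    have := norm_integral_le_of_norm_le (hi'.const_mul (1 / (K : ℝ))) (ae_of_all _ hle)
    refine this.trans ?_
    rw [integral_const_mul, integral_add (integrable_const _) hi]
    refine mul_le_mul_of_nonneg_left (add_le_add (by simp) (hB1.trans ?_)) (by positivity)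
    exact mul_le_mul_of_nonneg_right (Real.sqrt_le_sqrt hq1s) (Real.sqrt_nonneg _)
  have hT2 : |∫ p, ψ (f p.1) * steinT' f p.1 p.2 ∂ρ| ≤
      1 / (K : ℝ) * (3 / 2 * √m4 * √(∑ j, a j ^ 4)) := by
    have hle : ∀ p : (Fin n → ℝ) × (Fin n → ℝ),
        ‖ψ (f p.1) * steinT' f p.1 p.2‖ ≤
        1 / (K : ℝ) * |∑ j, (a j * |a j|) * q2 (p.1 j, p.2 j)| := by
      intro p
      rw [Real.norm_eq_abs, abs_mul, hf, steinT'_linear]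
      exact mul_le_mul_of_nonneg_right (hψb _) (abs_nonneg _)
    have hi : Integrable (fun p : (Fin n → ℝ) × (Fin n → ℝ) =>
        |∑ j, (a j * |a j|) * q2 (p.1 j, p.2 j)|) ρ := (hS2.integrable one_le_two).abs
    have := norm_integral_le_of_norm_le (hi.const_mul (1 / (K : ℝ))) (ae_of_all _ hle)
    refine this.trans ?_
    rw [integral_const_mul]
    refine mul_le_mul_of_nonneg_left (hB2.trans ?_) (by positivity)
    refine mul_le_mul_of_nonneg_right ?_ (Real.sqrt_nonneg _)
    -- Here `√2` is rounded up to `3/2`; with the coefficient `1` from `T` this gives the constant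
    -- `5/2`.
    rw [Real.sqrt_le_left (by positivity), mul_pow, Real.sq_sqrt (by linarith)]
    linarith
  refine hmain.trans ((add_le_add hT1 hT2).trans (le_of_eq ?_))
  ring

end LinearForm

/-! ### Conditioning on an independent vector. -/

section Independence

variable {Ω : Type*} {m0 : MeasurableSpace Ω} {P : Measure Ω} [IsProbabilityMeasure P]

/-- Conditioning on one of two independent random vectors. -/
lemma integral_indepFun_eq {α β : Type*} [MeasurableSpace α] [MeasurableSpace β] {W : Ω → α}
    {A : Ω → β} (hW : Measurable W) (hA : Measurable A) (h : IndepFun W A P) {G : α × β → ℝ}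
    (hG : Measurable G) {C : ℝ} (hC : ∀ p, |G p| ≤ C) :
    ∫ ω, G (W ω, A ω) ∂P = ∫ ω, ∫ x, G (x, A ω) ∂(P.map W) ∂P := by
  have := Measure.isProbabilityMeasure_map (μ := P) hW.aemeasurable
  have := Measure.isProbabilityMeasure_map (μ := P) hA.aemeasurable
  have e1 : ∫ ω, G (W ω, A ω) ∂P = ∫ p, G p ∂(P.map W).prod (P.map A) := by
    rw [← h.map_prod_eq_prod_map_map hW.aemeasurable hA.aemeasurable,
      integral_map (hW.prodMk hA).aemeasurable hG.aestronglyMeasurable]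
  rw [e1, integral_prod_symm _ (Integrable.of_bound hG.aestronglyMeasurable C (ae_of_all _ hC)),
    integral_map hA.aemeasurable]
  exact hG.stronglyMeasurable.integral_prod_left'.aestronglyMeasurable

end Independence

/-! ### Independence structure of the network. -/

namespace RandomNN

variable {Ω : Type*} [MeasurableSpace Ω] {P : Measure Ω} {L : ℕ} (N : RandomNN P L)
  (x : Fin (N.width 0) → ℝ)

/-- The output of layer `ℓ`: the input for `ℓ = 0`, and the activated neurons for `ℓ ≥ 1`. -/
def act : (ℓ : ℕ) → Fin (N.width ℓ) → Ω → ℝ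
  | 0 => fun k _ => x k
  | ℓ + 1 => fun k ω => N.σ (N.z x (ℓ + 1) k ω)

/-- The coefficients of the weights in `N.z x (ℓ + 1)`. -/
def coeff (ℓ : ℕ) (k : Fin (N.width ℓ)) (ω : Ω) : ℝ :=
  √(N.CW : ℝ) / √(N.width ℓ : ℝ) * N.act x ℓ k ω

lemma z_succ (ℓ : ℕ) (j : Fin (N.width (ℓ + 1))) (ω : Ω) :
    N.z x (ℓ + 1) j ω = N.bias ℓ j ω + ∑ k, N.coeff x ℓ k ω * N.weight ℓ j k ω := by
  cases ℓ <;>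
  · simp only [z, coeff, act, Finset.mul_sum]
    congr 1
    exact Finset.sum_congr rfl fun k _ => by ring

/-- The index type of the parameters of the network. -/
abbrev ParamIndex : Type :=
  (Σ ℓ : Fin (L + 1), Fin (N.width (ℓ + 1)) × Fin (N.width ℓ)) ⊕
    (Σ ℓ : Fin (L + 1), Fin (N.width (ℓ + 1)))

/-- The family of all parameters of the network. -/
def param : N.ParamIndex → Ω → ℝ :=
  Sum.elim (fun p => N.weight p.1 p.2.1 p.2.2) (fun p => N.bias p.1 p.2)

/-- The layer of a parameter. -/
def layer : N.ParamIndex → ℕ := Sum.elim (fun p => p.1) (fun p => p.1)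

/-- The σ-algebra generated by a set of parameters. -/
abbrev paramAlgebra (S : Set N.ParamIndex) : MeasurableSpace Ω :=
  ⨆ i ∈ S, MeasurableSpace.comap (N.param i) inferInstance

lemma measurable_param (i : N.ParamIndex) : Measurable (N.param i) := by
  rcases i with ⟨ℓ, j, k⟩ | ⟨ℓ, j⟩
  · exact N.measurable_weight ℓ (Nat.lt_succ_iff.1 ℓ.2) j k
  · exact N.measurable_bias ℓ (Nat.lt_succ_iff.1 ℓ.2) j

lemma measurable_param_paramAlgebra {S : Set N.ParamIndex} {i : N.ParamIndex} (hi : i ∈ S) :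
    Measurable[N.paramAlgebra S] (N.param i) :=
  Measurable.mono (comap_measurable _)
    (le_iSup₂ (f := fun i _ => MeasurableSpace.comap (N.param i) inferInstance) i hi) le_rfl

lemma paramAlgebra_mono {S T : Set N.ParamIndex} (h : S ⊆ T) :
    N.paramAlgebra S ≤ N.paramAlgebra T := biSup_mono h

lemma indep_paramAlgebra {S T : Set N.ParamIndex} (h : Disjoint S T) :
    Indep (N.paramAlgebra S) (N.paramAlgebra T) P :=
  indep_iSup_of_disjoint (fun i => (N.measurable_param i).comap_le) N.indep h

lemma paramAlgebra_le (S : Set N.ParamIndex) :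
    N.paramAlgebra S ≤ (inferInstance : MeasurableSpace Ω) :=
  iSup₂_le fun i _ => (N.measurable_param i).comap_le

lemma measurable_weight_paramAlgebra {S : Set N.ParamIndex} {ℓ : ℕ} (hℓ : ℓ < L + 1)
    {j : Fin (N.width (ℓ + 1))} {k : Fin (N.width ℓ)} (h : Sum.inl ⟨⟨ℓ, hℓ⟩, j, k⟩ ∈ S) :
    Measurable[N.paramAlgebra S] (N.weight ℓ j k) :=
  N.measurable_param_paramAlgebra h

lemma measurable_bias_paramAlgebra {S : Set N.ParamIndex} {ℓ : ℕ} (hℓ : ℓ < L + 1)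
    {j : Fin (N.width (ℓ + 1))} (h : Sum.inr ⟨⟨ℓ, hℓ⟩, j⟩ ∈ S) :
    Measurable[N.paramAlgebra S] (N.bias ℓ j) :=
  N.measurable_param_paramAlgebra h

/-- The output of layer `ℓ` is a function of the parameters of the previous layers. -/
lemma measurable_act_paramAlgebra : ∀ ℓ ≤ L, ∀ k,
    Measurable[N.paramAlgebra {i | N.layer i < ℓ}] (N.act x ℓ k) := by
  intro ℓ
  induction ℓ with
  | zero => exact fun _ k => measurable_const
  | succ ℓ ih =>
    intro hℓ k
    have hl : ℓ < L + 1 := by omega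
    have e : N.act x (ℓ + 1) k = fun ω => N.σ (N.bias ℓ k ω +
        ∑ i, N.coeff x ℓ i ω * N.weight ℓ k i ω) := by
      funext ω; simp only [act, z_succ]
    rw [e]
    have hb : Measurable[N.paramAlgebra {i | N.layer i < ℓ + 1}] (N.bias ℓ k) :=
      N.measurable_bias_paramAlgebra hl (Nat.lt_succ_self ℓ)
    have hw : ∀ i, Measurable[N.paramAlgebra {i | N.layer i < ℓ + 1}] (N.weight ℓ k i) :=
      fun i => N.measurable_weight_paramAlgebra hl (Nat.lt_succ_self ℓ)
    have ha : ∀ i, Measurable[N.paramAlgebra {i | N.layer i < ℓ + 1}] (N.coeff x ℓ i) :=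
      fun i => ((ih (by omega) i).mono (N.paramAlgebra_mono fun i hi => by
        simp only [Set.mem_ofPred_eq] at hi ⊢; omega) le_rfl).const_mul _
    exact N.measurable_σ.comp (hb.add (Finset.measurable_sum _ fun i _ => (ha i).mul (hw i)))

lemma measurable_act {ℓ : ℕ} (hℓ : ℓ ≤ L) (k : Fin (N.width ℓ)) : Measurable (N.act x ℓ k) :=
  (N.measurable_act_paramAlgebra x ℓ hℓ k).mono (N.paramAlgebra_le _) le_rfl

lemma measurable_coeff {ℓ : ℕ} (hℓ : ℓ ≤ L) (k : Fin (N.width ℓ)) : Measurable (N.coeff x ℓ k) :=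
  (N.measurable_act x hℓ k).const_mul _

lemma measurable_z_succ {ℓ : ℕ} (hℓ : ℓ ≤ L) (j : Fin (N.width (ℓ + 1))) :
    Measurable (N.z x (ℓ + 1) j) := by
  have e : N.z x (ℓ + 1) j = fun ω => N.bias ℓ j ω +
      ∑ i, N.coeff x ℓ i ω * N.weight ℓ j i ω := funext fun ω => N.z_succ x ℓ j ω
  rw [e]
  exact (N.measurable_bias ℓ hℓ j).add (Finset.measurable_sum _ fun i _ =>
    (N.measurable_coeff x hℓ i).mul (N.measurable_weight ℓ hℓ j i))

lemma indepFun_of_measurable {α β : Type*} [MeasurableSpace α] [MeasurableSpace β]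
    {S T : Set N.ParamIndex} (h : Disjoint S T) {Y : Ω → α} {Z : Ω → β}
    (hY : Measurable[N.paramAlgebra S] Y) (hZ : Measurable[N.paramAlgebra T] Z) :
    IndepFun Y Z P :=
  (IndepFun_iff_Indep _ _ _).2 (indep_of_indep_of_le_left
    (indep_of_indep_of_le_right (N.indep_paramAlgebra h) hZ.comap_le) hY.comap_le)

lemma map_weight_row {ℓ : ℕ} (hℓ : ℓ ≤ L) (j : Fin (N.width (ℓ + 1))) :
    P.map (fun ω k => N.weight ℓ j k ω) = Measure.pi fun _ => N.weightLaw := by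
  have hinj : Function.Injective fun k : Fin (N.width ℓ) =>
      (Sum.inl ⟨⟨ℓ, Nat.lt_succ_of_le hℓ⟩, j, k⟩ : N.ParamIndex) := by
    intro k k' h
    simpa using h
  have hi := N.indep.precomp hinj
  replace hi : iIndepFun (fun k => N.weight ℓ j k) P := hi
  rw [hi.map_fun_eq_pi_map fun k => (N.measurable_weight ℓ hℓ j k).aemeasurable]
  congr 1
  funext k
  exact (N.hasLaw_weight ℓ hℓ j k).map_eq

lemma memLp_weightLaw_six
    (h6 : Integrable (fun ω => N.weight 0 (N.fst 1) (N.fst 0) ω ^ 6) P) :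
    MemLp id 6 N.weightLaw ∧
      ∫ ω, N.weight 0 (N.fst 1) (N.fst 0) ω ^ 6 ∂P = ∫ u, u ^ 6 ∂N.weightLaw := by
  have hl := N.hasLaw_weight 0 (Nat.zero_le L) (N.fst 1) (N.fst 0)
  have hm := N.measurable_weight 0 (Nat.zero_le L) (N.fst 1) (N.fst 0)
  constructor
  · have h := memLp_of_integrable_pow (n := 6) hm.aestronglyMeasurable (by norm_num)
      (by simpa [Even.pow_abs (by decide : Even 6)] using h6)
    rw [← hl.map_eq]
    exact (memLp_map_measure_iff aestronglyMeasurable_id hm.aemeasurable).2 (by exact_mod_cast h)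
  · exact hl.integral_comp (f := fun u => u ^ 6) (by fun_prop)

variable [IsProbabilityMeasure P]

lemma isProbabilityMeasure_weightLaw : IsProbabilityMeasure N.weightLaw :=
  (N.hasLaw_weight 0 (Nat.zero_le L) (N.fst 1) (N.fst 0)).isProbabilityMeasure_iff.1 inferInstance

/-- The distribution function of a neuron, by conditioning on the previous layer. -/
lemma map_z_succ_real_Iic {ℓ : ℕ} (hℓ : ℓ ≤ L) (j : Fin (N.width (ℓ + 1))) (t : ℝ) :
    (P.map (N.z x (ℓ + 1) j)).real (Set.Iic t) =
      ∫ ω, ∫ u, (gaussianReal 0 N.Cb).real (Set.Iic (t - ∑ k, N.coeff x ℓ k ω * u k))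
        ∂(Measure.pi fun _ => N.weightLaw) ∂P := by
  have hl : ℓ < L + 1 := by omega
  set past : Set N.ParamIndex := {i | N.layer i < ℓ} with hpast
  -- The neuron uses three disjoint groups of parameters: all earlier layers (through the
  -- coefficients), its own row of weights and its own bias.
  set row : Set N.ParamIndex := Set.range fun k => Sum.inl ⟨⟨ℓ, hl⟩, j, k⟩ with hrow
  set bia : Set N.ParamIndex := {Sum.inr ⟨⟨ℓ, hl⟩, j⟩} with hbia
  have hpr : Disjoint row past := by
    rw [Set.disjoint_left]
    rintro _ ⟨k, rfl⟩ h
    exact lt_irrefl ℓ h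
  have hbr : Disjoint bia (row ∪ past) := by
    rw [hbia, Set.disjoint_singleton_left]
    rintro (⟨k, h⟩ | h)
    · simp at h
    · exact lt_irrefl ℓ h
  have hA : ∀ k, Measurable[N.paramAlgebra past] (N.coeff x ℓ k) := fun k =>
    (N.measurable_act_paramAlgebra x ℓ hℓ k).const_mul _
  have hW : ∀ k, Measurable[N.paramAlgebra row] (N.weight ℓ j k) := fun k =>
    N.measurable_weight_paramAlgebra hl ⟨k, rfl⟩
  have hb : Measurable[N.paramAlgebra bia] (N.bias ℓ j) :=
    N.measurable_bias_paramAlgebra hl rfl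
  set Y : Ω → ℝ := fun ω => ∑ k, N.coeff x ℓ k ω * N.weight ℓ j k ω with hY
  have hYm : Measurable[N.paramAlgebra (row ∪ past)] Y :=
    Finset.measurable_sum _ fun k _ =>
      ((hA k).mono (N.paramAlgebra_mono Set.subset_union_right) le_rfl).mul
      ((hW k).mono (N.paramAlgebra_mono Set.subset_union_left) le_rfl)
  have hbY : IndepFun (N.bias ℓ j) Y P := N.indepFun_of_measurable hbr hb hYm
  have hWA : IndepFun (fun ω k => N.weight ℓ j k ω) (fun ω k => N.coeff x ℓ k ω) P :=
    N.indepFun_of_measurable hpr (@measurable_pi_lambda _ _ _ (N.paramAlgebra row) _ _ hW)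
      (@measurable_pi_lambda _ _ _ (N.paramAlgebra past) _ _ hA)
  have e : N.z x (ℓ + 1) j = fun ω => N.bias ℓ j ω + Y ω := funext fun ω => N.z_succ x ℓ j ω
  have hm : Measurable fun y : ℝ => (gaussianReal 0 N.Cb).real (Set.Iic (t - y)) := by
    have : Monotone fun y => (gaussianReal 0 N.Cb).real (Set.Iic y) := fun a b hab =>
      measureReal_mono (Set.Iic_subset_Iic.2 hab)
    exact this.measurable.comp (measurable_id.const_sub t)
  rw [e, map_add_gaussianReal_real_Iic (N.hasLaw_bias ℓ hℓ j)
    (hYm.mono (N.paramAlgebra_le _) le_rfl).aemeasurable hbY, ← N.map_weight_row hℓ j]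
  refine integral_indepFun_eq (C := 1)
    (G := fun p : (Fin (N.width ℓ) → ℝ) × (Fin (N.width ℓ) → ℝ) =>
      (gaussianReal 0 N.Cb).real (Set.Iic (t - ∑ k, p.2 k * p.1 k)))
    (measurable_pi_lambda _ fun k => N.measurable_weight ℓ hℓ j k)
    (measurable_pi_lambda _ fun k => N.measurable_coeff x hℓ k) hWA (hm.comp (by fun_prop))
    fun p => ?_
  rw [abs_of_nonneg measureReal_nonneg]
  exact measureReal_le_one

/-- All neurons of a layer have the same law. -/
lemma map_z_succ_eq {ℓ : ℕ} (hℓ : ℓ ≤ L) (j j' : Fin (N.width (ℓ + 1))) :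
    P.map (N.z x (ℓ + 1) j) = P.map (N.z x (ℓ + 1) j') := by
  have h1 := Measure.isProbabilityMeasure_map (μ := P) (N.measurable_z_succ x hℓ j).aemeasurable
  have h2 := Measure.isProbabilityMeasure_map (μ := P) (N.measurable_z_succ x hℓ j').aemeasurable
  refine Measure.ext_of_Iic _ _ fun t => ?_
  -- The conditional formula for the distribution function does not involve `j`.
  rw [← measureReal_eq_measureReal_iff, N.map_z_succ_real_Iic x hℓ, N.map_z_succ_real_Iic x hℓ]

/-! ### The bound for an output neuron. -/

section KolmogorovBound

/-- The activated neurons of a layer have the same moments. -/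
lemma integral_act_pow {ℓ : ℕ} (hℓ : ℓ + 1 ≤ L) {p : ENNReal} (k : Fin (N.width (ℓ + 1)))
    (h : MemLp (fun ω => N.σ (N.z x (ℓ + 1) (N.fst (ℓ + 1)) ω)) p P) (n : ℕ) :
    MemLp (fun ω => N.σ (N.z x (ℓ + 1) k ω)) p P ∧
      ∫ ω, N.σ (N.z x (ℓ + 1) k ω) ^ n ∂P =
        ∫ ω, N.σ (N.z x (ℓ + 1) (N.fst (ℓ + 1)) ω) ^ n ∂P := by
  have hz := fun j => N.measurable_z_succ x (Nat.le_of_succ_le hℓ) j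
  have hid : IdentDistrib (N.z x (ℓ + 1) (N.fst (ℓ + 1))) (N.z x (ℓ + 1) k) P P :=
    ⟨(hz _).aemeasurable, (hz _).aemeasurable, N.map_z_succ_eq x (Nat.le_of_succ_le hℓ) _ _⟩
  have hσ := hid.comp N.measurable_σ
  refine ⟨hσ.memLp_iff.1 h, ?_⟩
  exact (hσ.comp (measurable_id.pow_const n)).integral_eq.symm

/-- The Kolmogorov bound for a neuron of the output layer, in terms of fourth moments. -/
theorem kolDist_output_le {ℓ : ℕ} (hℓ : ℓ + 1 = L)
    (hw4 : MemLp id 4 N.weightLaw)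
    (hs4 : MemLp (fun ω => N.σ (N.z x (ℓ + 1) (N.fst (ℓ + 1)) ω)) 4 P)
    (hK : N.K x (ℓ + 2) ≠ 0) :
    kolDist (P.map (N.z x (ℓ + 2) (N.fst (ℓ + 2)))) (gaussianReal 0 (N.K x (ℓ + 2))) ≤
      1 / (N.K x (ℓ + 2) : ℝ) * (√(N.Q x 2 (ℓ + 1)) + 5 / 2 * √(∫ u, u ^ 4 ∂N.weightLaw) *
        ((N.CW : ℝ) / √(N.width (ℓ + 1) : ℝ) *
          √(∫ ω, N.σ (N.z x (ℓ + 1) (N.fst (ℓ + 1)) ω) ^ 4 ∂P))) := by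
  have hpw := N.isProbabilityMeasure_weightLaw
  set K := N.K x (ℓ + 2) with hKdef
  set n : ℝ := (N.width (ℓ + 1) : ℝ) with hn
  have hn0 : 0 < n := Nat.cast_pos.2 (N.width_pos (ℓ + 1))
  have hCW : (0 : ℝ) < N.CW := by exact_mod_cast N.CW_pos
  set s : Fin (N.width (ℓ + 1)) → Ω → ℝ := fun k ω => N.σ (N.z x (ℓ + 1) k ω) with hs
  set s4 := ∫ ω, s (N.fst (ℓ + 1)) ω ^ 4 ∂P with hs4def
  have hsL : ∀ k, MemLp (s k) 4 P := fun k => (N.integral_act_pow x hℓ.le k hs4 4).1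
  have hsI : ∀ k, ∫ ω, s k ω ^ 4 ∂P = s4 := fun k => (N.integral_act_pow x hℓ.le k hs4 4).2
  have hco : ∀ k ω, N.coeff x (ℓ + 1) k ω = √(N.CW : ℝ) / √n * s k ω := fun _ _ => rfl
  have hc2 : ∀ k ω, N.coeff x (ℓ + 1) k ω ^ 2 = (N.CW : ℝ) / n * s k ω ^ 2 := fun k ω => by
    rw [hco, mul_pow, div_pow, Real.sq_sqrt hCW.le, Real.sq_sqrt hn0.le]
  have hc4 : ∀ k ω, N.coeff x (ℓ + 1) k ω ^ 4 = ((N.CW : ℝ) / n) ^ 2 * s k ω ^ 4 := fun k ω => by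
    rw [show (4 : ℕ) = 2 * 2 from rfl, pow_mul, hc2, mul_pow, ← pow_mul]
  set D : Ω → ℝ := fun ω => ∑ k, N.coeff x (ℓ + 1) k ω ^ 2 - K + N.Cb with hD
  set S : Ω → ℝ := fun ω => ∑ k, N.coeff x (ℓ + 1) k ω ^ 4 with hS
  have hcL : ∀ k, MemLp (fun ω => N.coeff x (ℓ + 1) k ω) 4 P := fun k => (hsL k).const_mul _
  have hc2L : ∀ k, MemLp (fun ω => N.coeff x (ℓ + 1) k ω ^ 2) 2 P := fun k => by
    simpa only [sq] using memLp_two_mul (hcL k) (hcL k)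
  have hDL : MemLp D 2 P :=
    ((memLp_finsetSum _ fun k _ => hc2L k).sub (memLp_const _)).add (memLp_const _)
  have hc4I : ∀ k, Integrable (fun ω => N.coeff x (ℓ + 1) k ω ^ 4) P := fun k => by
    simpa only [← pow_mul] using (hc2L k).integrable_sq
  have hSi : Integrable S P := integrable_finsetSum _ fun k _ => hc4I k
  have hS0 : ∀ ω, 0 ≤ S ω := fun ω => Finset.sum_nonneg fun k _ => by positivity
  -- There are `n` equal contributions `(C_W / n)² s4`, which is where the rate `1 / √n` comes from
  -- after the square root.
  have hSint : ∫ ω, S ω ∂P = ((N.CW : ℝ) / √n) ^ 2 * s4 := by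
    rw [hS, integral_finsetSum _ fun k _ => hc4I k]
    simp_rw [hc4, integral_const_mul, hsI]
    rw [Finset.sum_const, Finset.card_univ, Fintype.card_fin, nsmul_eq_mul, ← hn, div_pow, div_pow,
      Real.sq_sqrt hn0.le]
    field_simp
  have hSL : MemLp (fun ω => √(S ω)) 2 P := by
    refine (memLp_two_iff_integrable_sq ?_).2 (by simpa only [Real.sq_sqrt (hS0 _)] using hSi)
    exact Real.continuous_sqrt.comp_aestronglyMeasurable hSi.aestronglyMeasurable
  have hQ : ∫ ω, D ω ^ 2 ∂P = N.Q x 2 (ℓ + 1) := by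
    rw [Q]
    refine integral_congr_ae (ae_of_all _ fun ω => ?_)
    simp only [hD, hc2, sq_abs]
    rfl
  have hD1 : ∫ ω, |D ω| ∂P ≤ √(N.Q x 2 (ℓ + 1)) := by
    rw [← hQ]; exact integral_abs_le_sqrt hDL
  have hS1 : ∫ ω, √(S ω) ∂P ≤ (N.CW : ℝ) / √n * √s4 := by
    have h := integral_abs_le_sqrt hSL
    simp only [abs_of_nonneg (Real.sqrt_nonneg _), Real.sq_sqrt (hS0 _)] at h
    rwa [hSint, Real.sqrt_mul (sq_nonneg _), Real.sqrt_sq (by positivity)] at h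
  refine kolDist_le fun t => ?_
  rw [N.map_z_succ_real_Iic x hℓ.le]
  set I : Ω → ℝ := fun ω =>
    ∫ u, (gaussianReal 0 N.Cb).real (Set.Iic (t - ∑ k, N.coeff x (ℓ + 1) k ω * u k))
      ∂(Measure.pi fun _ => N.weightLaw) with hI
  set m4 := ∫ u, u ^ 4 ∂N.weightLaw with hm4
  -- The bound for linear forms is applied at each fixed `ω`, with the realised coefficients as
  -- constants.
  have hbound : ∀ ω, ‖I ω - (gaussianReal 0 K).real (Set.Iic t)‖ ≤
      1 / (K : ℝ) * (|D ω| + 5 / 2 * √m4 * √(S ω)) := fun ω =>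
    abs_integral_linear_gaussianReal_sub_le hw4 N.mean_weightLaw N.sq_weightLaw
      (fun k => N.coeff x (ℓ + 1) k ω) N.Cb hK t
  have hIm : AEStronglyMeasurable I P := by
    have hm : Measurable fun y : ℝ => (gaussianReal 0 N.Cb).real (Set.Iic (t - y)) := by
      have : Monotone fun y => (gaussianReal 0 N.Cb).real (Set.Iic y) := fun a b hab =>
        measureReal_mono (Set.Iic_subset_Iic.2 hab)
      exact this.measurable.comp (measurable_id.const_sub t)
    have hc := fun k => N.measurable_coeff x hℓ.le k
    have : Measurable fun p : Ω × (Fin (N.width (ℓ + 1)) → ℝ) =>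
        (gaussianReal 0 N.Cb).real (Set.Iic (t - ∑ k, N.coeff x (ℓ + 1) k p.1 * p.2 k)) :=
      hm.comp (Finset.measurable_sum _ fun k _ =>
        ((hc k).comp measurable_fst).mul ((measurable_pi_apply k).comp measurable_snd))
    exact this.stronglyMeasurable.integral_prod_right'.aestronglyMeasurable
  have hIi : Integrable I P := Integrable.of_bound hIm 1 (ae_of_all _ fun ω => by
    refine (norm_integral_le_of_norm_le_const (C := 1) (ae_of_all _ fun u => ?_)).trans (by simp)
    rw [Real.norm_eq_abs, abs_of_nonneg measureReal_nonneg]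
    exact measureReal_le_one)
  have e1 : ∫ ω, I ω ∂P - (gaussianReal 0 K).real (Set.Iic t) =
      ∫ ω, (I ω - (gaussianReal 0 K).real (Set.Iic t)) ∂P := by
    rw [integral_sub hIi (integrable_const _)]; simp
  have i1 : Integrable (fun ω => |D ω|) P := (hDL.integrable one_le_two).abs
  have i2 : Integrable (fun ω => 5 / 2 * √m4 * √(S ω)) P :=
    (hSL.integrable one_le_two).const_mul _
  have i3 : Integrable (fun ω => |D ω| + 5 / 2 * √m4 * √(S ω)) P := i1.add i2
  rw [e1]
  refine (norm_integral_le_of_norm_le (i3.const_mul (1 / (K : ℝ))) (ae_of_all _ hbound)).trans ?_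
  rw [integral_const_mul, integral_add i1 i2, integral_const_mul]
  gcongr

end KolmogorovBound

end RandomNN

/-! ### Comparison of fourth and sixth moments. -/

lemma sqrt_integral_pow_four_le {Ω : Type*} [MeasurableSpace Ω] {P : Measure Ω}
    [IsProbabilityMeasure P] {Y : Ω → ℝ} (hY : MemLp Y 6 P) :
    √(∫ ω, Y ω ^ 4 ∂P) ≤ 1 + √(∫ ω, |Y ω| ^ 6 ∂P) := by
  have i6 : Integrable (fun ω => |Y ω| ^ 6) P := by
    have hY' : MemLp Y ((6 : ℕ) : ENNReal) P := by exact_mod_cast hY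
    simpa using hY'.integrable_norm_pow'
  -- Pointwise `y⁴ ≤ 1 + |y|⁶`, because `a³ - a² - a + 1 = (a + 1) (a - 1)²` is nonnegative for `a =
  -- y²`.
  have h : ∫ ω, Y ω ^ 4 ∂P ≤ ∫ ω, (1 + |Y ω| ^ 6) ∂P := by
    refine integral_mono_of_nonneg (ae_of_all _ fun ω => by positivity)
      ((integrable_const 1).add i6) (ae_of_all _ fun ω => ?_)
    simp only
    have e4 : Y ω ^ 4 = (|Y ω| ^ 2) ^ 2 := by rw [sq_abs]; ring
    have e6 : |Y ω| ^ 6 = (|Y ω| ^ 2) ^ 3 := by ring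
    rw [e4, e6]
    have := sq_nonneg |Y ω|
    nlinarith [mul_nonneg this (sq_nonneg (|Y ω| ^ 2 - 1)), sq_nonneg (|Y ω| ^ 2 - 1)]
  rw [integral_add (integrable_const 1) i6] at h
  simp only [integral_const, probReal_univ, one_smul] at h
  have h0 : 0 ≤ ∫ ω, |Y ω| ^ 6 ∂P := integral_nonneg fun ω => by positivity
  rw [Real.sqrt_le_left (by positivity)]
  nlinarith [Real.sq_sqrt h0, Real.sqrt_nonneg (∫ ω, |Y ω| ^ 6 ∂P)]

/-- The normalisation `E[x²] = 1` cancels the lower-order terms of a pointwise inequality, so the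
comparison needs no additive constant. -/
lemma integral_pow_four_le_pow_six {w : Measure ℝ} [IsProbabilityMeasure w] (h6 : MemLp id 6 w)
    (h2 : ∫ x, x ^ 2 ∂w = 1) : ∫ x, x ^ 4 ∂w ≤ ∫ x, x ^ 6 ∂w := by
  have h6' : MemLp id ((6 : ℕ) : ENNReal) w := by exact_mod_cast h6
  have i6 : Integrable (fun x : ℝ => x ^ 6) w := by
    simpa [Even.pow_abs (by decide : Even 6)] using h6'.integrable_norm_pow'
  have h4 : MemLp id ((4 : ℕ) : ENNReal) w := h6'.mono_exponent (by norm_num)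
  have i4 : Integrable (fun x : ℝ => x ^ 4) w := by
    simpa [Even.pow_abs (by decide : Even 4)] using h4.integrable_norm_pow'
  have i2 : Integrable (fun x : ℝ => x ^ 2) w := (h4.mono_exponent (by norm_num)).integrable_sq
  -- `x⁶ - x⁴ - x² + 1 ≥ 0`
  have h : ∫ x, (x ^ 4 + (x ^ 2 - 1)) ∂w ≤ ∫ x, x ^ 6 ∂w :=
    integral_mono (i4.add (i2.sub (integrable_const 1))) i6 fun x => by
      simp only
      nlinarith [mul_nonneg (by positivity : 0 ≤ x ^ 2 + 1) (sq_nonneg (x ^ 2 - 1))]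
  have i21 : Integrable (fun x : ℝ => x ^ 2 - 1) w := i2.sub (integrable_const 1)
  rw [integral_add i4 i21, integral_sub i2 (integrable_const 1), h2] at h
  simpa using h

end

/-! ### Assembly of the two bounds. -/

theorem mainTheorem6 {Ω : Type*} [MeasurableSpace Ω] (P : Measure Ω) [IsProbabilityMeasure P] :
    -- the bound for the neural network
    (∀ (L : ℕ), 1 ≤ L → ∀ (N : RandomNN P L) (x : Fin (N.width 0) → ℝ),
      Integrable (fun ω => N.weight 0 (N.fst 1) (N.fst 0) ω ^ 6) P →
      Integrable (fun ω => |N.σ (N.z x L (N.fst L) ω)| ^ 6) P →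
      N.K x (L + 1) ≠ 0 →
      kolDist (P.map (N.z x (L + 1) (N.fst (L + 1)))) (gaussianReal 0 (N.K x (L + 1))) ≤
        1 / (N.K x (L + 1) : ℝ) * √(N.Q x 2 L) +
        (N.CW : ℝ) / ((N.K x (L + 1) : ℝ) * √(N.width L : ℝ)) *
          √(∫ ω, N.weight 0 (N.fst 1) (N.fst 0) ω ^ 6 ∂P) *
          (1 + √(∫ ω, |N.σ (N.z x L (N.fst L) ω)| ^ 6 ∂P)) *
          (2 * √((N.CW : ℝ) / (N.K x (L + 1) : ℝ)) +
            2 * √(N.CW : ℝ) *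
              (√((N.Cb : ℝ) / (N.K x (L + 1) : ℝ)) + √(2 * Real.pi) / 4) +
            5 / 2)) ∧
    -- the bound for a Gaussian variable plus a function of independent variables
    (∀ {E : Type*} [TopologicalSpace E] [PolishSpace E] [MeasurableSpace E] [BorelSpace E]
      (k : ℕ) (X X' : Ω → Fin k → E) (b : Ω → ℝ) (f : (Fin k → E) → ℝ) (Cb K : ℝ≥0),
      Measurable X → Measurable X' → Measurable b → Measurable f →
      iIndepFun (fun i ω => X ω i) P →
      IdentDistrib X' X P P → IndepFun X X' P →
      HasLaw b (gaussianReal 0 Cb) P → IndepFun b X P →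
      K ≠ 0 →
      Integrable (fun ω => f (X ω) ^ 6) P →
      ∫ ω, f (X ω) ∂P = 0 →
      kolDist (P.map (fun ω => b ω + f (X ω))) (gaussianReal 0 K) ≤
        1 / (K : ℝ) *
          √(∫ ω, (P[fun ω' => (K : ℝ) - (Cb : ℝ) - steinT f (X ω') (X' ω') |
            MeasurableSpace.comap X inferInstance] ω) ^ 2 ∂P) +
        1 / (K : ℝ) *
          √(variance (P[fun ω' => steinT' f (X ω') (X' ω') |
            MeasurableSpace.comap X inferInstance]) P) +
        1 / 4 * (√((Cb : ℝ) / (K : ℝ)) + √(2 * Real.pi) / 4) *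
          ∑ j : Fin k, 1 / (K : ℝ) * ∫ ω, |resampleDiff f j ∅ (X ω) (X' ω)| ^ 3 ∂P +
        1 / (4 * (K : ℝ) * √(K : ℝ)) *
          ∑ j : Fin k, √(∫ ω, |resampleDiff f j ∅ (X ω) (X' ω)| ^ 6 ∂P)) := by
  refine ⟨?_, ?_⟩
  · intro L hL N x hw6 hs6 hK
    obtain ⟨ℓ, rfl⟩ : ∃ ℓ, L = ℓ + 1 := ⟨L - 1, by omega⟩
    obtain ⟨hw, hwe⟩ := N.memLp_weightLaw_six hw6
    have hpw := N.isProbabilityMeasure_weightLaw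
    have hsm : Measurable fun ω => N.σ (N.z x (ℓ + 1) (N.fst (ℓ + 1)) ω) :=
      N.measurable_σ.comp (N.measurable_z_succ x (Nat.le_succ ℓ) _)
    have hs : MemLp (fun ω => N.σ (N.z x (ℓ + 1) (N.fst (ℓ + 1)) ω)) 6 P := by
      exact_mod_cast memLp_of_integrable_pow (n := 6) hsm.aestronglyMeasurable (by norm_num) hs6
    have hmain := N.kolDist_output_le x rfl (hw.mono_exponent (by norm_num))
      (hs.mono_exponent (by norm_num)) hK
    have hm : √(∫ u, u ^ 4 ∂N.weightLaw) ≤ √(∫ u, u ^ 6 ∂N.weightLaw) :=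
      Real.sqrt_le_sqrt (integral_pow_four_le_pow_six hw N.sq_weightLaw)
    have hσ := sqrt_integral_pow_four_le hs
    rw [hwe]
    refine hmain.trans ?_
    set M := √(∫ u, u ^ 6 ∂N.weightLaw)
    set S := √(∫ ω, |N.σ (N.z x (ℓ + 1) (N.fst (ℓ + 1)) ω)| ^ 6 ∂P)
    -- All of the last factor of the bound except `5/2`; being nonnegative, it only enlarges the
    -- right-hand side.
    set R := 2 * √((N.CW : ℝ) / (N.K x (ℓ + 1 + 1) : ℝ)) + 2 * √(N.CW : ℝ) *
      (√((N.Cb : ℝ) / (N.K x (ℓ + 1 + 1) : ℝ)) + √(2 * Real.pi) / 4)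
    have hR : 0 ≤ R := by positivity
    rw [mul_add]
    refine add_le_add le_rfl ?_
    calc 1 / (N.K x (ℓ + 2) : ℝ) * (5 / 2 * √(∫ u, u ^ 4 ∂N.weightLaw) *
          ((N.CW : ℝ) / √(N.width (ℓ + 1) : ℝ) *
            √(∫ ω, N.σ (N.z x (ℓ + 1) (N.fst (ℓ + 1)) ω) ^ 4 ∂P))) ≤
        1 / (N.K x (ℓ + 2) : ℝ) * ((R + 5 / 2) * M *
          ((N.CW : ℝ) / √(N.width (ℓ + 1) : ℝ) * (1 + S))) := by
          gcongr
          linarith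
      _ = _ := by rw [mul_comm (N.K x (ℓ + 1 + 1) : ℝ), ← div_div]; ring
  · intro E _ _ _ _ k X X' b f Cb K hX hX' _ hf hind hid hXX' hb hbX hK hf6 h0
    have hf4 : MemLp (fun ω => f (X ω)) 4 P := by
      have h := memLp_of_integrable_pow (n := 6) (hf.comp hX).aestronglyMeasurable (by norm_num)
        (by simpa [Even.pow_abs (by decide : Even 6)] using hf6)
      exact h.mono_exponent (by norm_num)
    have hmain := kolDist_add_le hX hX' hf hind hid hXX' hb hbX hK hf4 h0
    -- The third- and sixth-moment terms enter only through their sign.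
    have h3 : 0 ≤ 1 / 4 * (√((Cb : ℝ) / (K : ℝ)) + √(2 * Real.pi) / 4) *
        ∑ j : Fin k, 1 / (K : ℝ) * ∫ ω, |resampleDiff f j ∅ (X ω) (X' ω)| ^ 3 ∂P :=
      mul_nonneg (by positivity) (Finset.sum_nonneg fun j _ =>
        mul_nonneg (by positivity) (integral_nonneg fun ω => by positivity))
    have h4 : 0 ≤ 1 / (4 * (K : ℝ) * √(K : ℝ)) *
        ∑ j : Fin k, √(∫ ω, |resampleDiff f j ∅ (X ω) (X' ω)| ^ 6 ∂P) := by positivity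
    exact hmain.trans ((le_add_of_nonneg_right h3).trans (le_add_of_nonneg_right h4))
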